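/- All Hilbert spaces are complex and separable. Let $E$ and $E_*$ be Hilbert spaces, and write $\mathbb{T}$ for the unit circle with normalized Lebesgue measure and $\mathbb{D}$ for the open unit disc. For a Hilbert space $E$, let $H^2_E$ be the closed subspace of $L^2_E=L^2(\mathbb{T};E)$ consisting of the functions whose Fourier coefficients of negative index vanish (that is, the space of power series $\sum_{m\ge 0}a_mz^m$, $a_m\in E$, $\sum\|a_m\|^2<\infty$, identified with their boundary functions), and let $P_+^{E}$ be the orthogonal projection of $L^2_E$ onto $H^2_E$. Let $L^\infty_{B(E,E_*)}$ be the space of essentially bounded functions $\Phi$ on $\mathbb{T}$ with values in the bounded operators $B(E,E_*)$, measurable in the strong operator topology (functions equal a.e. being identified). For $\Phi\in L^\infty_{B(E,E_*)}$ the Toeplitz operator $T_\Phi:H^2_E\to H^2_{E_*}$ is $T_\Phi h=P_+^{E_*}(\Phi h)$. An inner function in $H^\infty_{B(F,E)}$ is an analytic function $\Theta:\mathbb{D}\to B(F,E)$ with $\|\Theta(z)a\|\le\|a\|$ for all $z\in\mathbb{D}$, $a\in F$, whose radial limit in the strong operator topology $\Theta(e^{it})$ is an isometry for a.e. $e^{it}\in\mathbb{T}$;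 $T_\Theta$ is the Toeplitz operator of its boundary function. A bounded operator $T$ is a partial isometry if $\|Th\|=\|h\|$ for all $h\in(\ker T)^\perp$. Let $\Phi\in L^\infty_{B(E,E_*)}$ be nonzero. Then $T_\Phi:H^2_E\to H^2_{E_*}$ is a partial isometry if and only if there exist a Hilbert space $F$ and inner functions $\Theta(z)=\sum_{m=0}^\infty\theta_mz^m\in H^\infty_{B(F,E_*)}$ and $\Psi(z)=\sum_{m=0}^\infty\psi_mz^m\in H^\infty_{B(F,E)}$ satisfying $\theta_m\psi_n^*=0$ for all $m,n\ge 1$ such that \[ T_\Phi=T_\Theta T_\Psi^*. \] -/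

import Mathlib

open MeasureTheory Filter Topology
open scoped ENNReal InnerProductSpace

noncomputable section

namespace HardyToeplitz

/-- The unit circle, parametrized by `t ∈ ℝ / 2πℤ`; the point `e^{it}` is `AddCircle.toCircle t`. -/
abbrev Torus : Type := AddCircle (2 * Real.pi)

instance factTwoPiPos : Fact (0 < 2 * Real.pi) := ⟨Real.two_pi_pos⟩

/-- The normalized Lebesgue measure on the unit circle. -/
abbrev circleMeasure : Measure Torus := AddCircle.haarAddCircle

/-- `L²_E`: the square integrable `E`-valued functions on the unit circle. -/
abbrev L2 (E : Type*) [NormedAddCommGroup E] : Type _ := Lp E 2 circleMeasure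

section Hardy

theorem integrable_L2 (E : Type*) [NormedAddCommGroup E] (f : L2 E) : Integrable (fun t => f t) circleMeasure :=
  (Lp.memLp f).integrable (by norm_num)

variable (E : Type*) [NormedAddCommGroup E] [InnerProductSpace ℂ E]

/-- The Hardy space `H²_E`, realized as the subspace of those `f ∈ L²_E` whose Fourier
coefficients of negative index all vanish. -/
def H2 : Submodule ℂ (L2 E) where
  carrier := {f | ∀ n : ℤ, n < 0 → fourierCoeff (fun t => f t) n = 0}
  zero_mem' := by
    intro n _
    have h : (fun t => fourier (-n) t • ((0 : L2 E) : Torus → E) t) =ᵐ[circleMeasure] 0 := by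
      filter_upwards [Lp.coeFn_zero E 2 circleMeasure] with t ht
      rw [ht, Pi.zero_apply, smul_zero]
    rw [fourierCoeff, integral_congr_ae h]
    simp
  add_mem' := by
    intro f g hf hg n hn
    have h : (fun t => fourier (-n) t • (f + g : L2 E) t) =ᵐ[circleMeasure]
        fun t => fourier (-n) t • ((fun t => f t) + fun t => g t) t := by
      filter_upwards [Lp.coeFn_add f g] with t ht
      rw [ht]
    rw [fourierCoeff, integral_congr_ae h]
    change fourierCoeff ((fun t => f t) + fun t => g t) n = 0
    rw [show fourierCoeff ((fun t => f t) + fun t => g t) = _ from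
      fourierCoeff.add (integrable_L2 E f) (integrable_L2 E g)]
    simp [hf n hn, hg n hn]
  smul_mem' := by
    intro c f hf n hn
    have h : (fun t => fourier (-n) t • (c • f : L2 E) t) =ᵐ[circleMeasure]
        fun t => fourier (-n) t • (c • (fun t => f t)) t := by
      filter_upwards [Lp.coeFn_smul c f] with t ht
      rw [ht]
    rw [fourierCoeff, integral_congr_ae h]
    change fourierCoeff (c • (fun t => f t)) n = 0
    rw [fourierCoeff.const_smul, hf n hn, smul_zero]

theorem mem_H2_iff (f : L2 E) :
    f ∈ H2 E ↔ ∀ n : ℤ, n < 0 → fourierCoeff (fun t => f t) n = 0 := Iff.rfl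

theorem norm_fourierCoeff_sub_le (f g : L2 E) (n : ℤ) :
    ‖fourierCoeff (fun t => f t) n - fourierCoeff (fun t => g t) n‖ ≤ ‖f - g‖ := by
  have hi : ∀ f : L2 E,
      Integrable (fun t => fourier (-n) t • f t) circleMeasure := fun f =>
    (integrable_L2 E f).fourier_smul (-n)
  have e : fourierCoeff (fun t => f t) n - fourierCoeff (fun t => g t) n
      = ∫ t, fourier (-n) t • (f - g : L2 E) t ∂circleMeasure := by
    rw [fourierCoeff, fourierCoeff, ← integral_sub (hi f) (hi g)]
    refine integral_congr_ae ?_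
    filter_upwards [Lp.coeFn_sub f g] with t ht
    rw [ht, Pi.sub_apply, smul_sub]
  rw [e]
  calc ‖∫ t, fourier (-n) t • (f - g : L2 E) t ∂circleMeasure‖
      ≤ ∫ t, ‖fourier (-n) t • (f - g : L2 E) t‖ ∂circleMeasure :=
        norm_integral_le_integral_norm _
    _ = ∫ t, ‖(f - g : L2 E) t‖ ∂circleMeasure := by
        refine integral_congr_ae (Eventually.of_forall fun t => ?_)
        change ‖fourier (-n) t • (f - g : L2 E) t‖ = _
        rw [norm_smul, fourier_apply, Circle.norm_coe, one_mul]
    _ = (eLpNorm (f - g : L2 E) 1 circleMeasure).toReal := by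
        rw [eLpNorm_one_eq_lintegral_enorm,
          integral_norm_eq_lintegral_enorm (Lp.aestronglyMeasurable _)]
    _ ≤ ‖f - g‖ := by
        rw [Lp.norm_def]
        exact ENNReal.toReal_mono (Lp.eLpNorm_ne_top _)
          (eLpNorm_le_eLpNorm_of_exponent_le (by norm_num) (Lp.aestronglyMeasurable _))

theorem isClosed_H2 : IsClosed (H2 E : Set (L2 E)) := by
  have h : (H2 E : Set (L2 E)) =
      ⋂ n : ℤ, ⋂ _ : n < 0, {f : L2 E | fourierCoeff (fun t => f t) n = 0} := by
    ext f
    simp [mem_H2_iff]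
  rw [h]
  refine isClosed_iInter fun n => isClosed_iInter fun _ => ?_
  refine isClosed_eq ?_ continuous_const
  refine (LipschitzWith.of_dist_le_mul (K := 1) fun f g => ?_).continuous
  simpa [dist_eq_norm] using norm_fourierCoeff_sub_le E f g n

instance completeSpace_H2 [CompleteSpace E] : CompleteSpace (H2 E) :=
  (isClosed_H2 E).completeSpace_coe

end Hardy

section Symbols

variable (E F : Type*) [NormedAddCommGroup E] [InnerProductSpace ℂ E]
  [NormedAddCommGroup F] [InnerProductSpace ℂ F]

/-- `L^∞_{B(E,F)}`: essentially bounded functions on the circle with values in the bounded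
operators from `E` to `F`. As usual for operator-valued functions, measurability is meant in the
strong operator topology. Elements are honest functions, not classes modulo a.e. equality. -/
structure LInfty where
  toFun : Torus → E →L[ℂ] F
  measurable' : ∀ x : E, AEStronglyMeasurable (fun t => toFun t x) circleMeasure
  bounded' : ∃ C : ℝ, ∀ᵐ t ∂circleMeasure, ‖toFun t‖ ≤ C

instance : CoeFun (LInfty E F) (fun _ => Torus → E →L[ℂ] F) := ⟨LInfty.toFun⟩

variable {E F}

theorem LInfty.aestronglyMeasurable_apply (Φ : LInfty E F) {h : Torus → E}
    (hh : AEStronglyMeasurable h circleMeasure) :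
    AEStronglyMeasurable (fun t => Φ t (h t)) circleMeasure := by
  obtain ⟨g, hg, hgh⟩ := hh
  have hs : ∀ s : SimpleFunc Torus E,
      AEStronglyMeasurable (fun t => Φ t (s t)) circleMeasure := by
    intro s
    have e : (fun t => Φ t (s t)) =
        fun t => ∑ c ∈ s.range, (s ⁻¹' {c}).indicator (fun t => Φ t c) t := by
      funext t
      rw [Finset.sum_eq_single (s t)]
      · simp
      · intro c _ hc
        simp [Set.indicator, Ne.symm hc]
      · intro hc
        exact absurd (s.mem_range_self t) hc
    rw [e]
    exact Finset.aestronglyMeasurable_fun_sum _ fun c _ =>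
      (Φ.measurable' c).indicator (s.measurableSet_fiber c)
  have hlim : AEStronglyMeasurable (fun t => Φ t (g t)) circleMeasure := by
    refine aestronglyMeasurable_of_tendsto_ae atTop (fun n => hs (hg.approx n)) ?_
    exact Eventually.of_forall fun t =>
      ((Φ t).continuous.tendsto _).comp (hg.tendsto_approx t)
  refine hlim.congr ?_
  filter_upwards [hgh] with t ht
  rw [ht]

theorem LInfty.memLp_apply (Φ : LInfty E F) (h : L2 E) :
    MemLp (fun t => Φ t (h t)) 2 circleMeasure := by
  obtain ⟨C, hC⟩ := Φ.bounded'
  refine (Lp.memLp h).of_le_mul (c := C)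
    (Φ.aestronglyMeasurable_apply (Lp.aestronglyMeasurable h)) ?_
  filter_upwards [hC] with t ht
  exact (Φ t).le_of_opNorm_le ht _

/-- The Laurent operator `L_Φ h = Φ h` from `L²_E` to `L²_F`. -/
def laurent (Φ : LInfty E F) : L2 E →L[ℂ] L2 F :=
  LinearMap.mkContinuousOfExistsBound
    { toFun := fun h => (Φ.memLp_apply h).toLp
      map_add' := by
        intro f g
        rw [← MemLp.toLp_add]
        refine MemLp.toLp_congr _ _ ?_
        filter_upwards [Lp.coeFn_add f g] with t ht
        rw [ht, Pi.add_apply, map_add]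
        rfl
      map_smul' := by
        intro c f
        rw [RingHom.id_apply, ← MemLp.toLp_const_smul]
        refine MemLp.toLp_congr _ _ ?_
        filter_upwards [Lp.coeFn_smul c f] with t ht
        rw [ht, Pi.smul_apply, map_smul]
        rfl }
    (by
      obtain ⟨C, hC⟩ := Φ.bounded'
      refine ⟨C, fun h => Lp.norm_le_mul_norm_of_ae_le_mul ?_⟩
      filter_upwards [hC, (Φ.memLp_apply h).coeFn_toLp] with t ht ht'
      change ‖((Φ.memLp_apply h).toLp) t‖ ≤ _
      rw [ht']
      exact (Φ t).le_of_opNorm_le ht _)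

theorem coeFn_laurent (Φ : LInfty E F) (h : L2 E) :
    (fun t => laurent Φ h t) =ᵐ[circleMeasure] fun t => Φ t (h t) :=
  (Φ.memLp_apply h).coeFn_toLp

/-- The Toeplitz operator `T_Φ h = P₊ (Φ h)` from `H²_E` to `H²_F`, where `P₊` is the orthogonal
projection of `L²_F` onto `H²_F`. -/
def toeplitz [CompleteSpace F] (Φ : LInfty E F) : H2 E →L[ℂ] H2 F :=
  (H2 F).orthogonalProjectionOnto ∘L laurent Φ ∘L (H2 E).subtypeL

end Symbols

section PartialIsometry

variable {H K : Type*} [NormedAddCommGroup H] [InnerProductSpace ℂ H]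
  [NormedAddCommGroup K] [InnerProductSpace ℂ K]

/-- `T` is a partial isometry if it is isometric on the orthogonal complement of its kernel. -/
def IsPartialIsometry (T : H →L[ℂ] K) : Prop :=
  ∀ h ∈ (LinearMap.ker (T : H →ₗ[ℂ] K))ᗮ, ‖T h‖ = ‖h‖

end PartialIsometry

section Inner

variable {E F : Type*} [NormedAddCommGroup E] [InnerProductSpace ℂ E]
  [NormedAddCommGroup F] [InnerProductSpace ℂ F]

/-- `A` is the radial limit, in the strong operator topology, of `Θ` at the boundary point
`e^{it}`. -/
def HasRadialLimit (Θ : ℂ → E →L[ℂ] F) (t : Torus) (A : E →L[ℂ] F) : Prop :=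
  ∀ x : E, Tendsto (fun r : ℝ => Θ ((r : ℂ) * (AddCircle.toCircle t : ℂ)) x) (𝓝[<] 1) (𝓝 (A x))

/-- A contractive analytic function on the open unit disc with values in the bounded operators
from `E` to `F`. Only the values of `Θ` on the open unit disc matter. -/
structure IsContractiveAnalytic (Θ : ℂ → E →L[ℂ] F) : Prop where
  differentiableOn : DifferentiableOn ℂ Θ (Metric.ball 0 1)
  contractive : ∀ z ∈ Metric.ball (0 : ℂ) 1, ∀ a : E, ‖Θ z a‖ ≤ ‖a‖

/-- An inner function: a contractive analytic function on the open unit disc whose radial limit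
`Θ(e^{it})` (in the strong operator topology) is an isometry for almost every `t`. -/
structure IsInner (Θ : ℂ → E →L[ℂ] F) : Prop extends IsContractiveAnalytic Θ where
  boundary : ∀ᵐ t ∂circleMeasure, ∃ A : E →L[ℂ] F, HasRadialLimit Θ t A ∧ ∀ a : E, ‖A a‖ = ‖a‖

open Classical in
/-- The boundary function `e^{it} ↦ Θ(e^{it})` given by strong radial limits (set to be `0` at
those points where the radial limit does not exist). -/
def boundaryValue (Θ : ℂ → E →L[ℂ] F) (t : Torus) : E →L[ℂ] F :=
  if h : ∃ A : E →L[ℂ] F, HasRadialLimit Θ t A then h.choose else 0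

theorem HasRadialLimit.boundaryValue_eq {Θ : ℂ → E →L[ℂ] F} {t : Torus} {A : E →L[ℂ] F}
    (h : HasRadialLimit Θ t A) : boundaryValue Θ t = A := by
  have h' : ∃ A : E →L[ℂ] F, HasRadialLimit Θ t A := ⟨A, h⟩
  rw [boundaryValue, dif_pos h']
  ext x
  exact tendsto_nhds_unique (h'.choose_spec x) (h x)

theorem IsInner.isometry_boundaryValue {Θ : ℂ → E →L[ℂ] F} (hΘ : IsInner Θ) :
    ∀ᵐ t ∂circleMeasure,
      HasRadialLimit Θ t (boundaryValue Θ t) ∧ ∀ a : E, ‖boundaryValue Θ t a‖ = ‖a‖ := by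
  filter_upwards [hΘ.boundary] with t ⟨A, hA, hiso⟩
  rw [hA.boundaryValue_eq]
  exact ⟨hA, hiso⟩

/-- The boundary function of an inner function, as an element of `L^∞`. -/
def IsInner.symbol {Θ : ℂ → E →L[ℂ] F} (hΘ : IsInner Θ) : LInfty E F where
  toFun := boundaryValue Θ
  measurable' := by
    intro x
    have hr : Tendsto (fun n : ℕ => (1 : ℝ) - 1 / ((n : ℝ) + 1)) atTop (𝓝[<] 1) := by
      refine tendsto_nhdsWithin_iff.2 ⟨?_, Eventually.of_forall fun n => ?_⟩
      · simpa using tendsto_const_nhds.sub (tendsto_one_div_add_atTop_nhds_zero_nat (𝕜 := ℝ))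
      · have : (0 : ℝ) < 1 / ((n : ℝ) + 1) := by positivity
        simpa using this
    refine aestronglyMeasurable_of_tendsto_ae atTop
      (f := fun (n : ℕ) (t : Torus) =>
        Θ (((1 - 1 / ((n : ℝ) + 1) : ℝ) : ℂ) * (AddCircle.toCircle t : ℂ)) x) (fun n => ?_) ?_
    · refine Continuous.aestronglyMeasurable ?_
      have hc : Continuous fun t : Torus =>
          Θ (((1 - 1 / ((n : ℝ) + 1) : ℝ) : ℂ) * (AddCircle.toCircle t : ℂ)) := by
        refine hΘ.differentiableOn.continuousOn.comp_continuous ?_ fun t => ?_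
        · exact continuous_const.mul
            (continuous_subtype_val.comp AddCircle.continuous_toCircle)
        · have h1 : (0 : ℝ) < 1 / ((n : ℝ) + 1) := by positivity
          have h2 : 1 / ((n : ℝ) + 1) ≤ 1 := by
            rw [div_le_one (by positivity)]
            linarith [(Nat.cast_nonneg n : (0 : ℝ) ≤ n)]
          rw [mem_ball_zero_iff, norm_mul, Circle.norm_coe, mul_one, Complex.norm_real,
            Real.norm_eq_abs, abs_of_nonneg (by linarith)]
          linarith
      exact hc.clm_apply continuous_const
    · filter_upwards [hΘ.isometry_boundaryValue] with t ht
      exact (ht.1 x).comp hr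
  bounded' := by
    refine ⟨1, ?_⟩
    filter_upwards [hΘ.isometry_boundaryValue] with t ht
    refine ContinuousLinearMap.opNorm_le_bound _ zero_le_one fun a => ?_
    rw [ht.2 a, one_mul]

/-- The `m`-th Taylor coefficient at the origin: `Θ(z) = ∑ θ_m z^m` with
`θ_m = Θ^{(m)}(0) / m!`. -/
def taylorCoeff (Θ : ℂ → E →L[ℂ] F) (m : ℕ) : E →L[ℂ] F :=
  ((m.factorial : ℂ)⁻¹) • iteratedDeriv m Θ 0

end Inner

end HardyToeplitz

end

universe u v

/-! Write `S` for the shift (multiplication by `z`), `T = T_Φ`, and `N = (ker T)ᗮ`. A Toeplitz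
operator satisfies `S* T S = T`.

Suppose `T` is a partial isometry. For `h ∈ N` this identity gives `⟪S T h, T S h⟫ = ‖T h‖² = ‖h‖²`,
while both vectors have norm at most `‖h‖`. So Cauchy–Schwarz is an equality, which forces `S h ∈ N`
and `T S h = S T h` (`IsPartialIsometry.shift_mem_initialSpace_and_eq`). Hence `N` is
shift-invariant, and by the Beurling–Lax–Halmos argument it is generated by its wandering subspace
`W = N ⊖ S N` (`eq_zero_of_inner_wandering_eq_zero`).

Take `F = W`. A vector `f` of `W` is orthogonal to `z^n f` for `n ≥ 1`, and so is `T f`, because `T`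
is isometric on `N` and commutes with `S` there. Then `‖f(t)‖²` has no nonzero Fourier coefficient
of nonzero index, so it is constant. Thus the inclusion of `W` and the restriction of `T` to `W` are
given by inner functions `Ψ` and `Θ` (`exists_isInner`); the radial limits come from Fatou's
theorem, proved here from the Poisson kernel and Lebesgue points. Now `T T_Ψ = T_Θ` on monomials,
and `T_Ψ T_Ψ*` is the projection onto `N`, whence `T = T T_Ψ T_Ψ* = T_Θ T_Ψ*`.

The coefficient relations express that `T_Θ T_Ψ*` is Toeplitz: for `g = z^k x` the commutator `T_Ψ*
S g - S T_Ψ* g` is the constant `ψ_{k+1}* x`, and the Toeplitz identity makes its image under `T_Θ`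
constant (`taylorCoeff_comp_adjoint_eq_zero`). Conversely, inner functions give isometric Toeplitz
operators, and `A B*` is a partial isometry for isometries `A`, `B`. -/

noncomputable section

namespace HardyToeplitz

/-! ### Fourier analysis of vector-valued `L²` functions on the circle. -/

section Fourier

variable {E : Type*} [NormedAddCommGroup E] [InnerProductSpace ℂ E]

/-- The trigonometric monomial `e^{it} ↦ e^{int} c`. -/
def monomial (n : ℤ) (c : E) : L2 E :=
  MemLp.toLp (fun t : Torus => fourier n t • c) (by
    refine (memLp_const c).of_le (by fun_prop) (Eventually.of_forall fun t => ?_)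
    simp [norm_smul, fourier_apply, Circle.norm_coe])

theorem coeFn_monomial (n : ℤ) (c : E) :
    (monomial n c : Torus → E) =ᵐ[circleMeasure] fun t => fourier n t • c :=
  MemLp.coeFn_toLp _

/-- The symbol `e^{int} I`. -/
def fourierSymbol (E : Type*) [NormedAddCommGroup E] [InnerProductSpace ℂ E] (n : ℤ) :
    LInfty E E where
  toFun t := fourier n t • ContinuousLinearMap.id ℂ E
  measurable' x := by
    simp only [smul_apply, ContinuousLinearMap.id_apply]
    fun_prop
  bounded' := by
    refine ⟨1, Eventually.of_forall fun t => ?_⟩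
    refine ContinuousLinearMap.opNorm_le_bound _ zero_le_one fun x => ?_
    simp [norm_smul, Circle.norm_coe]

/-- Multiplication by `e^{int}` on `L²_E`. -/
def mulFourier (n : ℤ) : L2 E →L[ℂ] L2 E := laurent (fourierSymbol E n)

theorem coeFn_mulFourier (n : ℤ) (f : L2 E) :
    (mulFourier n f : Torus → E) =ᵐ[circleMeasure] fun t => fourier n t • f t :=
  coeFn_laurent (fourierSymbol E n) f

theorem inner_mulFourier_mulFourier (n : ℤ) (f g : L2 E) :
    ⟪mulFourier n f, mulFourier n g⟫_ℂ = ⟪f, g⟫_ℂ := by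
  rw [L2.inner_def, L2.inner_def]
  refine integral_congr_ae ?_
  filter_upwards [coeFn_mulFourier n f, coeFn_mulFourier n g] with t h1 h2
  rw [h1, h2, inner_smul_left, inner_smul_right, ← mul_assoc, ← fourier_neg, ← fourier_add]
  simp

theorem norm_mulFourier (n : ℤ) (f : L2 E) : ‖mulFourier n f‖ = ‖f‖ := by
  rw [@norm_eq_sqrt_re_inner ℂ, @norm_eq_sqrt_re_inner ℂ, inner_mulFourier_mulFourier]

theorem mulFourier_monomial (k n : ℤ) (c : E) :
    mulFourier k (monomial n c) = monomial (k + n) c := by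
  refine Lp.ext ?_
  filter_upwards [coeFn_mulFourier k (monomial n c), coeFn_monomial n c,
    coeFn_monomial (k + n) c] with t h1 h2 h3
  rw [h1, h2, h3, smul_smul, fourier_add]

theorem fourierCoeff_mulFourier (k n : ℤ) (f : L2 E) :
    fourierCoeff (mulFourier k f) n = fourierCoeff f (n - k) := by
  refine integral_congr_ae ?_
  filter_upwards [coeFn_mulFourier k f] with t h
  rw [h, smul_smul, ← fourier_add]
  congr 3
  ring

theorem fourierCoeff_monomial [CompleteSpace E] (n m : ℤ) (c : E) :
    fourierCoeff (monomial n c) m = if m = n then c else 0 := by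
  rw [fourierCoeff_congr_ae (coeFn_monomial n c)]
  rw [fourierCoeff]
  simp_rw [smul_smul]
  rw [integral_smul_const]
  have := congrFun (fourierCoeff_fourier (T := 2 * Real.pi) n) m
  rw [fourierCoeff] at this
  simp only [smul_eq_mul] at this
  rw [this]
  simp only [Pi.single_apply, ite_smul, one_smul, zero_smul]

theorem inner_monomial_left [CompleteSpace E] (n : ℤ) (c : E) (f : L2 E) :
    ⟪monomial n c, f⟫_ℂ = ⟪c, fourierCoeff f n⟫_ℂ := by
  rw [L2.inner_def, fourierCoeff, ← integral_inner ((integrable_L2 E f).fourier_smul (-n))]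
  refine integral_congr_ae ?_
  filter_upwards [coeFn_monomial n c] with t h
  rw [h, inner_smul_left, inner_smul_right, fourier_neg]

/-- An integrable scalar function whose Fourier coefficients all vanish annihilates `C(𝕋)`. -/
theorem integral_continuousMap_mul_eq_zero {u : Torus → ℂ} (hu : Integrable u circleMeasure)
    (h : ∀ n : ℤ, fourierCoeff u n = 0) (φ : C(Torus, ℂ)) :
    ∫ t, φ t * u t ∂circleMeasure = 0 := by
  have hint : ∀ φ : C(Torus, ℂ), Integrable (fun t => φ t * u t) circleMeasure := fun φ =>
    hu.bdd_mul (c := ‖φ‖) φ.continuous.aestronglyMeasurable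
      (Eventually.of_forall fun t => φ.norm_coe_le_norm t)
  let L : C(Torus, ℂ) →L[ℂ] ℂ := LinearMap.mkContinuousOfExistsBound
    { toFun := fun φ => ∫ t, φ t * u t ∂circleMeasure
      map_add' := by
        intro φ ψ
        rw [← integral_add (hint φ) (hint ψ)]
        simp [add_mul]
      map_smul' := by
        intro c φ
        rw [RingHom.id_apply, ← integral_smul]
        simp [mul_assoc] }
    (by
      refine ⟨∫ t, ‖u t‖ ∂circleMeasure, fun φ => ?_⟩
      refine le_of_le_of_eq ?_ ((integral_const_mul ‖φ‖ _).trans (mul_comm _ _))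
      refine norm_integral_le_of_norm_le (hu.norm.const_mul _) (Eventually.of_forall fun t => ?_)
      rw [norm_mul]
      gcongr
      exact φ.norm_coe_le_norm t)
  have hker : (⊤ : Submodule ℂ C(Torus, ℂ)) ≤ LinearMap.ker (L : C(Torus, ℂ) →ₗ[ℂ] ℂ) := by
    rw [← span_fourier_closure_eq_top]
    refine Submodule.topologicalClosure_minimal _ (Submodule.span_le.2 ?_) L.isClosed_ker
    rintro _ ⟨n, rfl⟩
    have := h (-n)
    rw [fourierCoeff, neg_neg] at this
    exact this
  exact hker (Submodule.mem_top (x := φ))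

/-- A nonnegative integrable function all of whose Fourier coefficients of nonzero index vanish
is almost everywhere constant. -/
theorem ae_eq_integral_of_fourierCoeff_eq_zero {u : Torus → ℝ} (hu : Integrable u circleMeasure)
    (hu0 : ∀ t, 0 ≤ u t) (h : ∀ n : ℤ, n ≠ 0 → fourierCoeff (fun t => (u t : ℂ)) n = 0) :
    ∀ᵐ t ∂circleMeasure, u t = ∫ s, u s ∂circleMeasure := by
  set c : ℝ := ∫ s, u s ∂circleMeasure with hc
  have hc0 : 0 ≤ c := integral_nonneg hu0
  have hv : Integrable (fun t => ((u t : ℂ) - c)) circleMeasure :=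
    hu.ofReal.sub (integrable_const _)
  have key : ∀ φ : C(Torus, ℂ), ∫ t, φ t * ((u t : ℂ) - c) ∂circleMeasure = 0 := by
    refine integral_continuousMap_mul_eq_zero hv fun n => ?_
    have e : fourierCoeff (fun t => ((u t : ℂ) - c)) n =
        fourierCoeff (fun t => (u t : ℂ)) n - fourierCoeff (fun _ : Torus => (c : ℂ)) n := by
      simp_rw [fourierCoeff, smul_sub]
      exact integral_sub (Integrable.fourier_smul hu.ofReal _)
        (Integrable.fourier_smul (integrable_const _) _)
    have e2 : fourierCoeff (fun _ : Torus => (c : ℂ)) n = if n = 0 then (c : ℂ) else 0 := by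
      rw [← fourierCoeff_monomial 0 n (c : ℂ), fourierCoeff_congr_ae (coeFn_monomial 0 (c : ℂ))]
      simp
    rw [e, e2]
    split_ifs with hn
    · subst hn
      simp only [fourierCoeff, neg_zero, fourier_zero, one_smul]
      rw [integral_complex_ofReal, ← hc, sub_self]
    · rw [h n hn, sub_zero]
  -- Finite measures are determined by their integrals of continuous functions, so `u` and the
  -- constant `c` are densities of the same measure.
  have hmeas : (circleMeasure.withDensity fun t => ENNReal.ofReal (u t)) =
      circleMeasure.withDensity fun _ : Torus => ENNReal.ofReal c := by
    have : IsFiniteMeasure (circleMeasure.withDensity fun t => ENNReal.ofReal (u t)) :=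
      isFiniteMeasure_withDensity_ofReal hu.2
    have : IsFiniteMeasure (circleMeasure.withDensity fun _ : Torus => ENNReal.ofReal c) :=
      isFiniteMeasure_withDensity_ofReal (integrable_const c).2
    refine ext_of_forall_integral_eq_of_IsFiniteMeasure fun φ => ?_
    rw [integral_withDensity_eq_integral_toReal_smul₀ hu.1.aemeasurable.ennreal_ofReal (by simp),
      integral_withDensity_eq_integral_toReal_smul₀ (by fun_prop) (by simp)]
    have h1 := key ⟨fun t => (φ t : ℂ), by fun_prop⟩
    have h2 : ∫ t, φ t * (u t - c) ∂circleMeasure = 0 := by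
      rw [← Complex.ofReal_inj, ← integral_complex_ofReal]
      simpa using h1
    have hb : Integrable (fun t => φ t * u t) circleMeasure :=
      hu.bdd_mul (c := ‖φ‖) φ.continuous.aestronglyMeasurable
        (Eventually.of_forall fun t => φ.norm_coe_le_norm t)
    have hb' : Integrable (fun t => φ t * c) circleMeasure :=
      (integrable_const c).bdd_mul (c := ‖φ‖) φ.continuous.aestronglyMeasurable
        (Eventually.of_forall fun t => φ.norm_coe_le_norm t)
    simp_rw [mul_sub] at h2
    rw [integral_sub hb hb', sub_eq_zero] at h2
    simpa [ENNReal.toReal_ofReal, hu0, hc0, mul_comm] using h2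
  rw [withDensity_eq_iff hu.1.aemeasurable.ennreal_ofReal (by fun_prop) hu.lintegral_lt_top.ne]
    at hmeas
  filter_upwards [hmeas] with t ht
  rwa [ENNReal.ofReal_eq_ofReal_iff (hu0 t) hc0] at ht

/-- If `f` is orthogonal to `e^{int} f` for all `n ≥ 1`, then `f` has constant norm. -/
theorem ae_norm_eq_of_inner_mulFourier_eq_zero (f : L2 E)
    (h : ∀ n : ℕ, ⟪f, mulFourier (n + 1) f⟫_ℂ = 0) :
    ∀ᵐ t ∂circleMeasure, ‖f t‖ = ‖f‖ := by
  have hint : Integrable (fun t => ‖f t‖ ^ 2) circleMeasure :=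
    (Lp.memLp f).integrable_norm_pow (by norm_num)
  have hco : ∀ n : ℤ, fourierCoeff (fun t => ((‖f t‖ ^ 2 : ℝ) : ℂ)) (-n) =
      ⟪f, mulFourier n f⟫_ℂ := by
    intro n
    rw [L2.inner_def, fourierCoeff, neg_neg]
    refine integral_congr_ae ?_
    filter_upwards [coeFn_mulFourier n f] with t ht
    rw [ht, inner_smul_right, inner_self_eq_norm_sq_to_K, smul_eq_mul]
    simp
  have hpos : ∀ n : ℤ, 0 < n → ⟪f, mulFourier n f⟫_ℂ = 0 := by
    intro n hn
    obtain ⟨k, rfl⟩ : ∃ k : ℕ, n = k + 1 := ⟨(n - 1).toNat, by omega⟩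
    exact h k
  have hall := ae_eq_integral_of_fourierCoeff_eq_zero hint (fun t => by positivity) (by
    intro n hn
    rcases lt_or_gt_of_ne hn with hn | hn
    · rw [← neg_neg n, hco]
      exact hpos _ (by omega)
    -- For this sign, multiplying both entries by `e^{int}` moves the factor to the left entry;
    -- conjugate symmetry reduces to `hpos`.
    · rw [← neg_neg n, hco, ← inner_mulFourier_mulFourier n]
      have : mulFourier n (mulFourier (-n) f) = f := by
        refine Lp.ext ?_
        filter_upwards [coeFn_mulFourier n (mulFourier (-n) f), coeFn_mulFourier (-n) f]
          with t h1 h2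
        rw [h1, h2, smul_smul, ← fourier_add]
        simp
      rw [this, ← inner_conj_symm, hpos n hn, map_zero])
  have hn : ∫ s, ‖f s‖ ^ 2 ∂circleMeasure = ‖f‖ ^ 2 := by
    have := L2.inner_def (𝕜 := ℂ) f f
    rw [inner_self_eq_norm_sq_to_K] at this
    simp_rw [inner_self_eq_norm_sq_to_K] at this
    have h2 : ((‖f‖ ^ 2 : ℝ) : ℂ) = ((∫ s, ‖f s‖ ^ 2 ∂circleMeasure : ℝ) : ℂ) := by
      rw [← integral_complex_ofReal]
      simpa using this
    exact_mod_cast h2.symm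
  filter_upwards [hall] with t ht
  rw [hn] at ht
  exact (sq_eq_sq₀ (norm_nonneg _) (norm_nonneg _)).1 ht

variable [CompleteSpace E] [TopologicalSpace.SeparableSpace E]

/-- Pairing with a fixed vector reduces to the scalar Fourier basis. Separability of `E` is what
allows the exceptional null sets, one for each vector, to be merged into one. -/
theorem eq_zero_of_fourierCoeff_eq_zero (f : L2 E) (h : ∀ n : ℤ, fourierCoeff f n = 0) :
    f = 0 := by
  refine Lp.ext ?_
  refine EventuallyEq.trans ?_ (Lp.coeFn_zero E 2 circleMeasure).symm
  refine ae_eq_zero_of_forall_inner (𝕜 := ℂ) fun c => ?_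
  have hm : MemLp (fun t => ⟪c, f t⟫_ℂ) 2 circleMeasure := (Lp.memLp f).const_inner c
  have h0 : hm.toLp = 0 := by
    have hr : fourierBasis.repr (hm.toLp) = 0 := by
      ext n
      rw [fourierBasis_repr, fourierCoeff_congr_ae hm.coeFn_toLp]
      have : fourierCoeff (fun t => ⟪c, f t⟫_ℂ) n = ⟪c, fourierCoeff f n⟫_ℂ := by
        rw [fourierCoeff, fourierCoeff, ← integral_inner ((integrable_L2 E f).fourier_smul (-n))]
        refine integral_congr_ae (Eventually.of_forall fun t => ?_)
        simp only [inner_smul_right, smul_eq_mul]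
      rw [this, h n, inner_zero_right]
      rfl
    exact (LinearIsometryEquiv.map_eq_zero_iff _).1 hr
  exact (MemLp.toLp_eq_toLp_iff hm MemLp.zero).1 (by rw [h0, MemLp.toLp_zero])

end Fourier

/-! ### The shift and the monomials of the Hardy space. -/

section Hardy

variable {E : Type*} [NormedAddCommGroup E] [InnerProductSpace ℂ E]

theorem mulFourier_mem_H2 (n : ℕ) {f : L2 E} (hf : f ∈ H2 E) : mulFourier n f ∈ H2 E := by
  intro m hm
  have := fourierCoeff_mulFourier n m f
  rw [this]
  exact hf _ (by omega)

/-- The shift `h ↦ z h` on `H²_E`. -/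
def shift : H2 E →L[ℂ] H2 E :=
  (mulFourier 1 ∘L (H2 E).subtypeL).codRestrict (H2 E) fun f => mulFourier_mem_H2 1 f.2

theorem coe_shift (f : H2 E) : (shift f : L2 E) = mulFourier 1 (f : L2 E) := rfl

theorem coe_shift_iterate (n : ℕ) (f : H2 E) :
    ((shift^[n] f : H2 E) : L2 E) = mulFourier n (f : L2 E) := by
  induction n with
  | zero =>
    refine Lp.ext ?_
    filter_upwards [coeFn_mulFourier ((0 : ℕ) : ℤ) (f : L2 E)] with t h
    rw [h]
    simp
  | succ n ih =>
    rw [Function.iterate_succ_apply', coe_shift, ih]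
    refine Lp.ext ?_
    filter_upwards [coeFn_mulFourier 1 (mulFourier n (f : L2 E)), coeFn_mulFourier n (f : L2 E),
      coeFn_mulFourier ((n + 1 : ℕ) : ℤ) (f : L2 E)] with t h1 h2 h3
    rw [h1, h2, h3, smul_smul, ← fourier_add]
    congr 2
    push_cast
    ring_nf

theorem inner_shift_shift (f g : H2 E) : ⟪shift f, shift g⟫_ℂ = ⟪f, g⟫_ℂ :=
  inner_mulFourier_mulFourier 1 _ _

theorem norm_shift (f : H2 E) : ‖shift f‖ = ‖f‖ := norm_mulFourier 1 _

theorem fourierCoeff_shift (f : H2 E) (n : ℤ) :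
    fourierCoeff (shift f : L2 E) n = fourierCoeff (f : L2 E) (n - 1) :=
  fourierCoeff_mulFourier 1 n (f : L2 E)

variable [CompleteSpace E]

/-- The monomial `z^n c` in `H²_E`. -/
def hardyMonomial (n : ℕ) (c : E) : H2 E :=
  ⟨monomial n c, fun m hm => by
    have := fourierCoeff_monomial (n : ℤ) m c
    rw [this, if_neg (by omega)]⟩

theorem coe_hardyMonomial (n : ℕ) (c : E) : (hardyMonomial n c : L2 E) = monomial n c := rfl

theorem shift_hardyMonomial (n : ℕ) (c : E) :
    shift (hardyMonomial n c) = hardyMonomial (n + 1) c := by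
  refine Subtype.ext ?_
  rw [coe_shift, coe_hardyMonomial, mulFourier_monomial, coe_hardyMonomial]
  push_cast
  rw [add_comm]

theorem hardyMonomial_eq_iterate (n : ℕ) (c : E) :
    hardyMonomial n c = shift^[n] (hardyMonomial 0 c) := by
  induction n with
  | zero => rfl
  | succ n ih => rw [← shift_hardyMonomial, ih, Function.iterate_succ_apply']

theorem inner_hardyMonomial_left (n : ℕ) (c : E) (f : H2 E) :
    ⟪hardyMonomial n c, f⟫_ℂ = ⟪c, fourierCoeff (f : L2 E) n⟫_ℂ :=
  inner_monomial_left n c f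

variable [TopologicalSpace.SeparableSpace E]

theorem H2_ext_fourierCoeff {f g : H2 E}
    (h : ∀ n : ℕ, fourierCoeff (f : L2 E) n = fourierCoeff (g : L2 E) n) : f = g := by
  rw [← sub_eq_zero]
  refine Subtype.ext (eq_zero_of_fourierCoeff_eq_zero _ fun n => ?_)
  rcases lt_or_ge n 0 with hn | hn
  · exact (f - g).2 n hn
  · lift n to ℕ using hn
    refine ext_inner_left ℂ fun c => ?_
    rw [← inner_hardyMonomial_left, inner_sub_right, inner_hardyMonomial_left,
      inner_hardyMonomial_left, h n, sub_self, inner_zero_right]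

/-- A vector orthogonal to every `z^n c` has all Fourier coefficients zero, so the monomials span a
dense subspace. -/
theorem eq_top_of_hardyMonomial_mem {M : Submodule ℂ (H2 E)} (hM : IsClosed (M : Set (H2 E)))
    (h : ∀ n c, hardyMonomial n c ∈ M) : M = ⊤ := by
  rw [← hM.submodule_topologicalClosure_eq, Submodule.topologicalClosure_eq_top_iff,
    Submodule.eq_bot_iff]
  intro f hf
  refine H2_ext_fourierCoeff fun n => ext_inner_left ℂ fun c => ?_
  rw [← inner_hardyMonomial_left, ← inner_hardyMonomial_left,
    Submodule.inner_right_of_mem_orthogonal (h n c) hf, inner_zero_right]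

theorem clm_ext_hardyMonomial {G : Type*} [NormedAddCommGroup G] [InnerProductSpace ℂ G]
    {A B : H2 E →L[ℂ] G} (h : ∀ n c, A (hardyMonomial n c) = B (hardyMonomial n c)) : A = B := by
  have := eq_top_of_hardyMonomial_mem (M := LinearMap.eqLocus (A : H2 E →ₗ[ℂ] G) B)
    (isClosed_eq A.continuous B.continuous) h
  ext1 f
  exact (this ▸ Submodule.mem_top : f ∈ LinearMap.eqLocus (A : H2 E →ₗ[ℂ] G) B)

end Hardy

/-! ### The Poisson kernel and its behaviour at Lebesgue points. -/

section Poisson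

/-- The Poisson kernel on the circle. -/
def circlePoisson (r : ℝ) (s : Torus) : ℝ :=
  (1 - r ^ 2) / ‖1 - (r : ℂ) * fourier 1 s‖ ^ 2

theorem circlePoisson_nonneg {r : ℝ} (h0 : 0 ≤ r) (h1 : r < 1) (s : Torus) :
    0 ≤ circlePoisson r s :=
  div_nonneg (by nlinarith) (by positivity)

theorem norm_fourier_apply (n : ℤ) (t : Torus) : ‖fourier n t‖ = 1 := by
  rw [fourier_apply, Circle.norm_coe]

theorem fourier_pow (m : ℤ) (n : ℕ) (t : Torus) :
    (fourier m t : ℂ) ^ n = fourier (n * m) t := by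
  induction n with
  | zero => simp
  | succ n ih =>
    rw [pow_succ, ih, ← fourier_add]
    congr 2
    push_cast
    ring

theorem norm_real_mul_fourier {r : ℝ} (h0 : 0 ≤ r) (n : ℤ) (s : Torus) :
    ‖(r : ℂ) * fourier n s‖ = r := by
  rw [norm_mul, norm_fourier_apply, mul_one, Complex.norm_real, Real.norm_of_nonneg h0]

theorem one_sub_mul_fourier_ne_zero {r : ℝ} (h0 : 0 ≤ r) (h1 : r < 1) (s : Torus) :
    1 - (r : ℂ) * fourier 1 s ≠ 0 := by
  intro h
  have := norm_real_mul_fourier h0 1 s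
  rw [← sub_eq_zero.1 h, norm_one] at this
  linarith

theorem continuous_circlePoisson {r : ℝ} (h0 : 0 ≤ r) (h1 : r < 1) :
    Continuous (circlePoisson r) := by
  unfold circlePoisson
  refine Continuous.div (by fun_prop) (by fun_prop) fun s => ?_
  exact pow_ne_zero _ (norm_ne_zero_iff.2 (one_sub_mul_fourier_ne_zero h0 h1 s))

/-- `|1 - r e^{ix}|² = (1 - r)² + 2r(1 - cos x)`, with `2r ≥ 1`, `cos x ≤ 1 - 2x²/π²` on `[-π, π]`,
and `π² ≤ 10`. -/
theorem le_norm_one_sub_mul_fourier_sq {r : ℝ} (h0 : 1 / 2 ≤ r) (s : Torus) :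
    (1 - r) ^ 2 + ‖s‖ ^ 2 / 5 ≤ ‖1 - (r : ℂ) * fourier 1 s‖ ^ 2 := by
  obtain ⟨x, hx, rfl⟩ : ∃ x : ℝ, |x| ≤ Real.pi ∧ (x : Torus) = s := by
    induction s using QuotientAddGroup.induction_on with
    | H y =>
      refine ⟨toIocMod Real.two_pi_pos (-Real.pi) y, ?_, ?_⟩
      · have := toIocMod_mem_Ioc Real.two_pi_pos (-Real.pi) y
        rw [abs_le]
        constructor <;> linarith [this.1, this.2]
      · rw [toIocMod, AddCircle.coe_sub, AddCircle.coe_zsmul, AddCircle.coe_period]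
        simp
  have hnorm : ‖(x : Torus)‖ = |x| := by
    rw [AddCircle.norm_coe_eq_abs_iff _ Real.two_pi_pos.ne', abs_of_pos Real.two_pi_pos]
    linarith
  have hf : fourier 1 (x : Torus) = Complex.exp (x * Complex.I) := by
    rw [fourier_coe_apply]
    congr 1
    have : (Real.pi : ℂ) ≠ 0 := by exact_mod_cast Real.pi_ne_zero
    push_cast
    field_simp
  rw [hnorm, sq_abs, hf, Complex.exp_mul_I, ← Complex.ofReal_cos, ← Complex.ofReal_sin,
    ← Complex.normSq_eq_norm_sq, Complex.normSq_apply]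
  simp only [Complex.sub_re, Complex.one_re, Complex.mul_re, Complex.add_re, Complex.ofReal_re,
    Complex.I_re, Complex.I_im, Complex.ofReal_im, Complex.sub_im, Complex.one_im, Complex.mul_im,
    Complex.add_im, mul_zero, mul_one, zero_mul, sub_zero, add_zero, zero_add, zero_sub]
  have hc := Real.cos_le_one_sub_mul_cos_sq hx
  have hs := Real.sin_sq_add_cos_sq x
  have hpi : x ^ 2 / 5 ≤ 2 / Real.pi ^ 2 * x ^ 2 := by
    have : (1 : ℝ) / 5 ≤ 2 / Real.pi ^ 2 := by
      rw [div_le_div_iff₀ (by norm_num) (by positivity)]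
      nlinarith [Real.pi_lt_d2, Real.pi_pos]
    nlinarith [sq_nonneg x]
  have hsq := sq_nonneg x
  nlinarith

/-- The Poisson kernel is dominated by a superposition of normalized indicators of balls. -/
theorem circlePoisson_le_tsum {r : ℝ} (h0 : 1 / 2 ≤ r) (h1 : r < 1) (s : Torus) :
    circlePoisson r s ≤ ∑' k : ℕ, (Metric.closedBall (0 : Torus) (2 ^ k * (1 - r))).indicator
      (fun _ => 40 * (1 / 4) ^ k / (1 - r)) s := by
  set δ := 1 - r with hδ
  have hδ0 : 0 < δ := by rw [hδ]; linarith
  have hsummable : Summable fun k : ℕ => (Metric.closedBall (0 : Torus) (2 ^ k * δ)).indicator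
      (fun _ => 40 * (1 / 4 : ℝ) ^ k / δ) s := by
    refine Summable.of_nonneg_of_le (fun k => Set.indicator_nonneg (fun _ _ => by positivity) _)
      (fun k => Set.indicator_le_self' (fun _ _ => by positivity) _) ?_
    exact ((summable_geometric_of_lt_one (by norm_num) (by norm_num)).mul_left 40).div_const δ
  have hex : ∃ k : ℕ, ‖s‖ ≤ 2 ^ k * δ := by
    obtain ⟨k, hk⟩ := pow_unbounded_of_one_lt (‖s‖ / δ) (one_lt_two (α := ℝ))
    exact ⟨k, (div_le_iff₀ hδ0).1 hk.le⟩
  classical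
  -- The single term of the smallest ball containing `s` already dominates. If `k ≥ 1` then `‖s‖ >
  -- 2^(k-1) δ`, so the kernel is at most `2δ / (4^(k-1) δ² / 5) = 40 · 4^(-k) / δ`, which is where
  -- `40` comes from.
  let k := Nat.find hex
  have hk : ‖s‖ ≤ 2 ^ k * δ := Nat.find_spec hex
  refine le_trans ?_ (hsummable.le_tsum k fun j _ =>
    Set.indicator_nonneg (fun _ _ => by positivity) _)
  rw [Set.indicator_of_mem (by simpa using hk)]
  have hden := le_norm_one_sub_mul_fourier_sq h0 s
  rw [← hδ] at hden
  have hnum : 1 - r ^ 2 ≤ 2 * δ := by rw [hδ]; nlinarith [sq_nonneg (1 - r)]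
  have hq : circlePoisson r s ≤ 2 * δ / (δ ^ 2 + ‖s‖ ^ 2 / 5) := by
    rw [circlePoisson]
    gcongr
  refine hq.trans ?_
  rw [div_le_div_iff₀ (by positivity) hδ0]
  rcases Nat.eq_zero_or_pos k with h | h
  · rw [h]
    nlinarith [sq_nonneg ‖s‖, sq_nonneg δ]
  · have hk' : 2 ^ (k - 1) * δ < ‖s‖ := not_le.1 (Nat.find_min hex (by omega : k - 1 < k))
    obtain ⟨j, hj⟩ : ∃ j, k = j + 1 := ⟨k - 1, by omega⟩
    rw [hj, Nat.add_sub_cancel] at hk'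
    rw [hj]
    have e : (1 / 4 : ℝ) ^ (j + 1) * (2 ^ j) ^ 2 = 1 / 4 := by
      rw [pow_succ, ← pow_mul, mul_comm j 2, pow_mul, mul_right_comm, ← mul_pow]
      norm_num
    have hsq : (2 ^ j * δ) ^ 2 ≤ ‖s‖ ^ 2 := by gcongr
    have h4 : (0 : ℝ) ≤ (1 / 4) ^ (j + 1) := by positivity
    calc 2 * δ * δ = 40 * ((1 / 4 : ℝ) ^ (j + 1) * (2 ^ j) ^ 2) * δ ^ 2 / 5 := by rw [e]; ring
      _ = 40 * (1 / 4 : ℝ) ^ (j + 1) * ((2 ^ j * δ) ^ 2 / 5) := by ring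
      _ ≤ 40 * (1 / 4 : ℝ) ^ (j + 1) * (δ ^ 2 + ‖s‖ ^ 2 / 5) := by
        gcongr
        nlinarith [sq_nonneg δ]

theorem circleMeasure_closedBall_le (t : Torus) {ε : ℝ} (hε : 0 ≤ ε) :
    circleMeasure.real (Metric.closedBall t ε) ≤ ε := by
  have h := AddCircle.volume_closedBall (T := 2 * Real.pi) (x := t) ε
  rw [AddCircle.volume_eq_smul_haarAddCircle, Measure.smul_apply, smul_eq_mul] at h
  have h2 := congrArg ENNReal.toReal h
  rw [ENNReal.toReal_mul, ENNReal.toReal_ofReal Real.two_pi_pos.le,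
    ENNReal.toReal_ofReal (by positivity)] at h2
  change 2 * Real.pi * circleMeasure.real (Metric.closedBall t ε) = _ at h2
  have h3 : 2 * Real.pi * circleMeasure.real (Metric.closedBall t ε) ≤ 2 * ε :=
    h2.le.trans (min_le_right _ _)
  have h4 : 0 ≤ circleMeasure.real (Metric.closedBall t ε) := measureReal_nonneg
  nlinarith [Real.pi_gt_three]

/-- Lebesgue differentiation, at one full-measure set of points for all dyadic dilates `k`. The
differentiation theorem is applied to `volume`, which is `2π` times `circleMeasure`; the factor
cancels in averages. -/
theorem ae_tendsto_average_circle {E : Type*} [NormedAddCommGroup E] {f : Torus → E}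
    (hf : Integrable f circleMeasure) :
    ∀ᵐ t ∂circleMeasure, ∀ k : ℕ, Tendsto (fun r : ℝ =>
      ⨍ s in Metric.closedBall t (2 ^ k * (1 - r)), ‖f s - f t‖ ∂circleMeasure)
      (𝓝[<] 1) (𝓝 0) := by
  have hne : ENNReal.ofReal (2 * Real.pi) ≠ 0 := by
    simpa using Real.pi_pos
  have hv : LocallyIntegrable f (volume : Measure Torus) := by
    rw [AddCircle.volume_eq_smul_haarAddCircle]
    exact (hf.smul_measure ENNReal.ofReal_ne_top).locallyIntegrable
  have h := IsUnifLocDoublingMeasure.ae_tendsto_average_norm_sub (volume : Measure Torus) hv 1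
  rw [AddCircle.volume_eq_smul_haarAddCircle, Measure.ae_ennreal_smul_measure_eq hne] at h
  filter_upwards [h] with t ht k
  have hδ : Tendsto (fun r : ℝ => 2 ^ k * (1 - r)) (𝓝[<] 1) (𝓝[>] 0) := by
    refine tendsto_nhdsWithin_iff.2 ⟨?_, ?_⟩
    · have : Tendsto (fun r : ℝ => 2 ^ k * (1 - r)) (𝓝 1) (𝓝 (2 ^ k * (1 - 1))) :=
        (by fun_prop : Continuous fun r : ℝ => 2 ^ k * (1 - r)).tendsto 1
      rw [sub_self, mul_zero] at this
      exact this.mono_left nhdsWithin_le_nhds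
    · filter_upwards [self_mem_nhdsWithin] with r hr
      have : r < 1 := hr
      have : 0 < 1 - r := by linarith
      exact Set.mem_Ioi.2 (by positivity)
  have h2 := ht (fun _ : ℝ => t) _ hδ (by
    filter_upwards [self_mem_nhdsWithin] with r hr
    have : r < 1 := hr
    have : 0 ≤ 1 - r := by linarith
    exact Metric.mem_closedBall_self (by positivity))
  refine h2.congr fun r => ?_
  have hb : (ENNReal.ofReal (2 * Real.pi) • circleMeasure).real
      (Metric.closedBall t (2 ^ k * (1 - r))) =
      2 * Real.pi * circleMeasure.real (Metric.closedBall t (2 ^ k * (1 - r))) := by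
    rw [measureReal_ennreal_smul_apply, ENNReal.toReal_ofReal Real.two_pi_pos.le]
  rw [setAverage_eq, setAverage_eq, Measure.restrict_smul, integral_smul_measure, hb,
    ENNReal.toReal_ofReal Real.two_pi_pos.le, smul_smul, mul_inv, mul_right_comm,
    inv_mul_cancel₀ Real.two_pi_pos.ne', one_mul]

/-- At almost every point the Poisson integrals of the oscillation of a bounded function tend
to zero. -/
theorem ae_tendsto_integral_circlePoisson_mul {E : Type*} [NormedAddCommGroup E] {f : Torus → E}
    (hf : AEStronglyMeasurable f circleMeasure) {M : ℝ}
    (hM : ∀ᵐ t ∂circleMeasure, ‖f t‖ ≤ M) :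
    ∀ᵐ t ∂circleMeasure, Tendsto (fun r : ℝ =>
      ∫ s, circlePoisson r (t - s) * ‖f s - f t‖ ∂circleMeasure) (𝓝[<] 1) (𝓝 0) := by
  have hfi : Integrable f circleMeasure := Integrable.of_bound hf M hM
  filter_upwards [ae_tendsto_average_circle hfi, hM] with t ht htM
  have hM0 : 0 ≤ M := (norm_nonneg _).trans htM
  set g : Torus → ℝ := fun s => ‖f s - f t‖ with hg
  have hgm : AEStronglyMeasurable g circleMeasure :=
    (hf.sub aestronglyMeasurable_const).norm
  have hgM : ∀ᵐ s ∂circleMeasure, g s ≤ 2 * M := by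
    filter_upwards [hM] with s hs
    exact (norm_sub_le _ _).trans (by linarith)
  have hgi : Integrable g circleMeasure := (hfi.sub (integrable_const _)).norm
  have hg0 : ∀ s, 0 ≤ g s := fun s => norm_nonneg _
  let B : ℝ → ℕ → Set Torus := fun r k => Metric.closedBall t (2 ^ k * (1 - r))
  let A : ℝ → ℕ → ℝ := fun r k => ⨍ s in B r k, g s ∂circleMeasure
  have hA0 : ∀ r k, 0 ≤ A r k := fun r k => by
    simp only [A]
    rw [setAverage_eq]
    exact smul_nonneg (by positivity) (integral_nonneg hg0)
  have hset : ∀ r k, ∫ s in B r k, g s ∂circleMeasure = circleMeasure.real (B r k) * A r k := by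
    intro r k
    exact (measure_smul_setAverage _ (measure_ne_top _ _)).symm
  have hsetM : ∀ r k, ∫ s in B r k, g s ∂circleMeasure ≤ circleMeasure.real (B r k) * (2 * M) := by
    intro r k
    refine (integral_mono_ae hgi.integrableOn (integrable_const (2 * M))
      (ae_restrict_of_ae hgM)).trans_eq ?_
    rw [setIntegral_const, smul_eq_mul]
  have hAM : ∀ r k, A r k ≤ 2 * M := by
    intro r k
    rcases eq_or_lt_of_le (measureReal_nonneg (μ := circleMeasure) (s := B r k)) with h | h
    · simp only [A]
      rw [setAverage_eq, ← h, inv_zero, zero_smul]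
      positivity
    · have := hset r k ▸ hsetM r k
      exact le_of_mul_le_mul_left this h
  -- The `k`-th ball has measure at most `2^k (1 - r)`, which turns the weight `40 · 4^(-k) / (1 -
  -- r)` into the summable `40 · 2^(-k)`, uniformly in `r`.
  have hbound : ∀ r : ℝ, 1 / 2 ≤ r → r < 1 →
      ∫ s, circlePoisson r (t - s) * g s ∂circleMeasure ≤ ∑' k : ℕ, 40 * (1 / 2) ^ k * A r k := by
    intro r h0 h1
    have hδ0 : 0 < 1 - r := by linarith
    let a : ℕ → ℝ := fun k => 40 * (1 / 4) ^ k / (1 - r)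
    have ha0 : ∀ k, 0 ≤ a k := fun k => by positivity
    have ha : Summable a :=
      ((summable_geometric_of_lt_one (by norm_num) (by norm_num)).mul_left 40).div_const _
    let G : ℕ → Torus → ℝ := fun k s => (B r k).indicator (fun s => a k * g s) s
    have hG0 : ∀ k s, 0 ≤ G k s := fun k s =>
      Set.indicator_nonneg (fun s _ => mul_nonneg (ha0 k) (hg0 s)) s
    have hGa : ∀ k s, G k s ≤ a k * g s := fun k s =>
      Set.indicator_le_self' (fun s _ => mul_nonneg (ha0 k) (hg0 s)) s
    have hGs : ∀ s, Summable fun k => G k s := fun s =>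
      Summable.of_nonneg_of_le (fun k => hG0 k s) (fun k => hGa k s) (ha.mul_right _)
    have hGm : ∀ k, AEStronglyMeasurable (G k) circleMeasure := fun k =>
      (hgm.const_mul (a k)).indicator Metric.isClosed_closedBall.measurableSet
    have hsum : HasSum (fun k => ∫ s, G k s ∂circleMeasure)
        (∫ s, ∑' k, G k s ∂circleMeasure) := by
      refine hasSum_integral_of_dominated_convergence (fun k s => a k * g s) hGm
        (fun k => Eventually.of_forall fun s => ?_)
        (Eventually.of_forall fun s => ha.mul_right _) ?_
        (Eventually.of_forall fun s => (hGs s).hasSum)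
      · rw [Real.norm_of_nonneg (hG0 k s)]
        exact hGa k s
      · simp_rw [tsum_mul_right]
        exact hgi.const_mul _
    have hGint : Integrable (fun s => ∑' k, G k s) circleMeasure := by
      have hm : AEStronglyMeasurable (fun s => ∑' k, G k s) circleMeasure := by
        refine aestronglyMeasurable_of_tendsto_ae atTop
          (f := fun n s => ∑ k ∈ Finset.range n, G k s)
          (fun n => Finset.aestronglyMeasurable_fun_sum _ fun k _ => hGm k) ?_
        exact Eventually.of_forall fun s => (hGs s).hasSum.tendsto_sum_nat
      refine (hgi.const_mul (∑' k, a k)).mono' hm (Eventually.of_forall fun s => ?_)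
      rw [Real.norm_of_nonneg (tsum_nonneg fun k => hG0 k s), ← tsum_mul_right]
      exact (hGs s).tsum_le_tsum (fun k => hGa k s) (ha.mul_right _)
    have hle : ∫ s, circlePoisson r (t - s) * g s ∂circleMeasure ≤
        ∫ s, ∑' k, G k s ∂circleMeasure := by
      refine integral_mono_of_nonneg (Eventually.of_forall fun s =>
        mul_nonneg (circlePoisson_nonneg (by linarith) h1 _) (hg0 s)) hGint
        (Eventually.of_forall fun s => ?_)
      refine (mul_le_mul_of_nonneg_right (circlePoisson_le_tsum h0 h1 (t - s)) (hg0 s)).trans ?_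
      rw [← tsum_mul_right]
      refine le_of_eq (tsum_congr fun k => ?_)
      have hmem : t - s ∈ Metric.closedBall (0 : Torus) (2 ^ k * (1 - r)) ↔ s ∈ B r k := by
        rw [mem_closedBall_zero_iff, norm_sub_rev, ← dist_eq_norm]
        rfl
      by_cases hs : s ∈ B r k
      · simp only [G]
        rw [Set.indicator_of_mem hs, Set.indicator_of_mem (hmem.2 hs)]
      · simp only [G]
        rw [Set.indicator_of_notMem hs, Set.indicator_of_notMem (mt hmem.1 hs), zero_mul]
    have hGk : ∀ k, ∫ s, G k s ∂circleMeasure ≤ 40 * (1 / 2) ^ k * A r k := by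
      intro k
      simp only [G]
      rw [integral_indicator Metric.isClosed_closedBall.measurableSet, integral_const_mul,
        hset r k]
      have hm := circleMeasure_closedBall_le t (ε := 2 ^ k * (1 - r)) (by positivity)
      calc a k * (circleMeasure.real (B r k) * A r k)
          ≤ a k * ((2 ^ k * (1 - r)) * A r k) := by
            have := ha0 k
            have := hA0 r k
            gcongr
        _ = 40 * (1 / 2) ^ k * A r k := by
            simp only [a]
            have e : (1 / 4 : ℝ) ^ k = (1 / 2) ^ k * (1 / 2) ^ k := by
              rw [← mul_pow]; norm_num
            have e2 : (1 / 2 : ℝ) ^ k * 2 ^ k = 1 := by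
              rw [← mul_pow]; norm_num
            rw [e]
            calc _ = 40 * ((1 / 2) ^ k * ((1 / 2) ^ k * 2 ^ k)) * ((1 - r) / (1 - r)) * A r k := by
                  ring
              _ = _ := by rw [e2, div_self hδ0.ne', mul_one, mul_one]
    refine hle.trans ?_
    rw [← hsum.tsum_eq]
    refine hsum.summable.tsum_le_tsum hGk ?_
    refine Summable.of_nonneg_of_le (fun k => mul_nonneg (by positivity) (hA0 r k))
      (fun k => mul_le_mul_of_nonneg_left (hAM r k) (by positivity)) ?_
    exact ((summable_geometric_of_lt_one (by norm_num) (by norm_num)).mul_left 40).mul_right _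
  have hev : ∀ᶠ r : ℝ in 𝓝[<] 1, 1 / 2 ≤ r ∧ r < 1 := by
    have h1 : ∀ᶠ r : ℝ in 𝓝[<] 1, 1 / 2 ≤ r :=
      nhdsWithin_le_nhds (Ici_mem_nhds (by norm_num : (1 / 2 : ℝ) < 1))
    filter_upwards [h1, self_mem_nhdsWithin] with r h h' using ⟨h, h'⟩
  -- Each average tends to `0` and all are at most `2M`, so dominated convergence applies to the
  -- series.
  have hlim : Tendsto (fun r => ∑' k : ℕ, 40 * (1 / 2) ^ k * A r k) (𝓝[<] 1) (𝓝 0) := by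
    have := tendsto_tsum_of_dominated_convergence (𝓕 := 𝓝[<] (1 : ℝ))
      (f := fun r k => 40 * (1 / 2) ^ k * A r k) (g := fun _ : ℕ => (0 : ℝ))
      (bound := fun k : ℕ => 40 * (1 / 2) ^ k * (2 * M))
      (((summable_geometric_of_lt_one (by norm_num) (by norm_num)).mul_left 40).mul_right _)
      (fun k => by
        have := (ht k).const_mul (40 * (1 / 2) ^ k)
        rwa [mul_zero] at this)
      (Eventually.of_forall fun r k => by
        rw [Real.norm_of_nonneg (mul_nonneg (by positivity) (hA0 r k))]
        exact mul_le_mul_of_nonneg_left (hAM r k) (by positivity))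
    rwa [tsum_zero] at this
  refine squeeze_zero' ?_ ?_ hlim
  · filter_upwards [hev] with r hr
    exact integral_nonneg fun s =>
      mul_nonneg (circlePoisson_nonneg (by linarith [hr.1]) hr.2 _) (hg0 s)
  · filter_upwards [hev] with r hr using hbound r hr.1 hr.2

end Poisson

/-! ### Power series as Cauchy and Poisson integrals, and Fatou's theorem. -/

section Cauchy

variable {E : Type*} [NormedAddCommGroup E] [InnerProductSpace ℂ E]

/-- Integrating a geometric series in a character against `f` gives the power series in the
Fourier coefficients of `f`. -/
theorem hasSum_pow_smul_fourierCoeff {f : Torus → E} (hf : Integrable f circleMeasure) (m : ℤ)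
    {z : ℂ} (hz : ‖z‖ < 1) :
    HasSum (fun n : ℕ => z ^ n • fourierCoeff f (n * m))
      (∫ s, (1 - z * fourier (-m) s)⁻¹ • f s ∂circleMeasure) := by
  have hw : ∀ s : Torus, ‖z * fourier (-m) s‖ = ‖z‖ := fun s => by
    rw [norm_mul, norm_fourier_apply, mul_one]
  have h := hasSum_integral_of_dominated_convergence (μ := circleMeasure)
    (F := fun (n : ℕ) s => (z * fourier (-m) s) ^ n • f s)
    (f := fun s => (1 - z * fourier (-m) s)⁻¹ • f s)
    (fun n s => ‖z‖ ^ n * ‖f s‖)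
    (fun n => (by fun_prop : Continuous fun s : Torus =>
      (z * fourier (-m) s) ^ n).aestronglyMeasurable.smul hf.1)
    (fun n => Eventually.of_forall fun s => by rw [norm_smul, norm_pow, hw])
    (Eventually.of_forall fun s =>
      (summable_geometric_of_lt_one (norm_nonneg z) hz).mul_right _)
    (by
      simp_rw [tsum_mul_right]
      exact hf.norm.const_mul _)
    (Eventually.of_forall fun s =>
      (hasSum_geometric_of_norm_lt_one (by rwa [hw])).smul_const _)
  convert h using 2 with n
  rw [fourierCoeff, ← integral_smul]
  refine integral_congr_ae (Eventually.of_forall fun s => ?_)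
  simp only
  rw [mul_pow, smul_smul]
  rw [fourier_pow]
  congr 4
  ring

end Cauchy

section Cauchy

/-- With `w = r e^{i(t-s)}` this is `(1 - |w|²)/|1 - w|² = 1/(1 - w) + 1/(1 - w̄) - 1`. The
exponents are left as `-1` and `-(-1)` to match `hasSum_pow_smul_fourierCoeff` with `m = 1` and `m =
-1`. -/
theorem circlePoisson_eq_inv_add_inv_sub_one {r : ℝ} (h0 : 0 ≤ r) (h1 : r < 1) (t s : Torus) :
    (circlePoisson r (t - s) : ℂ) = (1 - r * fourier 1 t * fourier (-1) s)⁻¹ +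
      (1 - r * fourier (-1) t * fourier (-(-1)) s)⁻¹ - 1 := by
  set w : ℂ := r * fourier 1 (t - s) with hw
  have hts : (fourier 1 (t - s) : ℂ) = fourier 1 t * fourier (-1) s := by
    simp [fourier_apply, sub_eq_add_neg, AddCircle.toCircle_add]
  have e1 : (r : ℂ) * fourier 1 t * fourier (-1) s = w := by
    rw [hw, hts, mul_assoc]
  have e2 : (r : ℂ) * fourier (-1) t * fourier (-(-1)) s = (starRingEnd ℂ) w := by
    rw [← e1, map_mul, map_mul, Complex.conj_ofReal, ← fourier_neg, ← fourier_neg]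
  have hww : w * (starRingEnd ℂ) w = r ^ 2 := by
    rw [Complex.mul_conj, Complex.normSq_eq_norm_sq, hw, norm_real_mul_fourier h0]
    push_cast
    rfl
  have hne : 1 - w ≠ 0 := one_sub_mul_fourier_ne_zero h0 h1 _
  have hne' : 1 - (starRingEnd ℂ) w ≠ 0 := by
    intro h
    apply hne
    have := congrArg (starRingEnd ℂ) h
    simpa using this
  have hden : ((‖1 - w‖ ^ 2 : ℝ) : ℂ) = (1 - w) * (1 - (starRingEnd ℂ) w) := by
    rw [← Complex.normSq_eq_norm_sq, ← Complex.mul_conj, map_sub, map_one]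
  rw [e1, e2, circlePoisson, Complex.ofReal_div, ← hw, hden]
  field_simp
  push_cast
  linear_combination hww

variable {E : Type*} [NormedAddCommGroup E] [InnerProductSpace ℂ E]

/-- The Poisson integral of a function with vanishing negative Fourier coefficients is its
power series. -/
theorem hasSum_integral_circlePoisson {f : Torus → E} (hf : Integrable f circleMeasure)
    (hneg : ∀ n : ℤ, n < 0 → fourierCoeff f n = 0) {r : ℝ} (h0 : 0 ≤ r) (h1 : r < 1) (t : Torus) :
    HasSum (fun n : ℕ => ((r : ℂ) * AddCircle.toCircle t) ^ n • fourierCoeff f n)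
      (∫ s, circlePoisson r (t - s) • f s ∂circleMeasure) := by
  have A := hasSum_pow_smul_fourierCoeff hf 1 (z := r * fourier 1 t)
    (by rwa [norm_real_mul_fourier h0])
  have B := hasSum_pow_smul_fourierCoeff hf (-1) (z := r * fourier (-1) t)
    (by rwa [norm_real_mul_fourier h0])
  -- The conjugate Cauchy kernel sees only the coefficients of index `≤ 0`, of which only the zeroth
  -- survives; it cancels the `-1` in the kernel.
  have B0 : ∫ s, (1 - r * fourier (-1) t * fourier (-(-1)) s)⁻¹ • f s ∂circleMeasure =
      ∫ s, f s ∂circleMeasure := by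
    have e : fourierCoeff f 0 = ∫ s, f s ∂circleMeasure := by simp [fourierCoeff]
    rw [← e]
    refine B.unique ?_
    convert hasSum_ite_eq (0 : ℕ) (fourierCoeff f 0) using 2 with n
    split_ifs with hn
    · simp [hn]
    · rw [hneg _ (by omega), smul_zero]
  have hint : ∀ n m : ℤ, Integrable (fun s => (1 - r * fourier n t * fourier m s)⁻¹ • f s)
      circleMeasure := by
    intro n m
    have hne : ∀ s : Torus, 1 - r * fourier n t * fourier m s ≠ 0 := by
      intro s h
      have : ‖(r : ℂ) * fourier n t * fourier m s‖ = r := by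
        rw [norm_mul, norm_real_mul_fourier h0, norm_fourier_apply, mul_one]
      rw [← sub_eq_zero.1 h, norm_one] at this
      linarith
    have hc : Continuous fun s : Torus => (1 - (r : ℂ) * fourier n t * fourier m s)⁻¹ :=
      Continuous.inv₀ (by fun_prop) hne
    let φ : C(Torus, ℂ) := ⟨_, hc⟩
    exact hf.bdd_smul ‖φ‖ hc.aestronglyMeasurable
      (Eventually.of_forall fun s => φ.norm_coe_le_norm s)
  have e : ∫ s, circlePoisson r (t - s) • f s ∂circleMeasure =
      ∫ s, (1 - r * fourier 1 t * fourier (-1) s)⁻¹ • f s ∂circleMeasure := by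
    have h2 : ∫ s, circlePoisson r (t - s) • f s ∂circleMeasure =
        ∫ s, (((1 - r * fourier 1 t * fourier (-1) s)⁻¹ • f s +
          (1 - r * fourier (-1) t * fourier (-(-1)) s)⁻¹ • f s) - f s) ∂circleMeasure := by
      refine integral_congr_ae (Eventually.of_forall fun s => ?_)
      simp only
      rw [← add_smul, ← Complex.coe_smul, circlePoisson_eq_inv_add_inv_sub_one h0 h1, sub_smul,
        one_smul]
    have h3 := integral_sub ((hint 1 (-1)).add (hint (-1) (-(-1)))) hf
    simp only [Pi.add_apply] at h3
    rw [h2, h3, integral_add (hint _ _) (hint _ _), B0,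
      add_sub_cancel_right]
  rw [e]
  simpa only [mul_one, fourier_one] using A

theorem integral_circlePoisson {r : ℝ} (h0 : 0 ≤ r) (h1 : r < 1) (t : Torus) :
    ∫ s, circlePoisson r (t - s) ∂circleMeasure = 1 := by
  have hc : ∀ n : ℤ, fourierCoeff (fun _ : Torus => (1 : ℂ)) n = if n = 0 then 1 else 0 := by
    intro n
    rw [← fourierCoeff_monomial 0 n (1 : ℂ), fourierCoeff_congr_ae (coeFn_monomial 0 (1 : ℂ))]
    simp
  have h := hasSum_integral_circlePoisson (f := fun _ : Torus => (1 : ℂ)) (integrable_const _)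
    (fun n hn => by rw [hc, if_neg hn.ne]) h0 h1 t
  have h2 : HasSum (fun n : ℕ => ((r : ℂ) * AddCircle.toCircle t) ^ n •
      fourierCoeff (fun _ : Torus => (1 : ℂ)) n) 1 := by
    convert hasSum_ite_eq (0 : ℕ) (1 : ℂ) using 2 with n
    rw [hc]
    split_ifs with h h' h'
    · simp_all
    · simp_all
    · simp_all
    · simp
  have h3 := h.unique h2
  have h4 : ∫ s, circlePoisson r (t - s) • (1 : ℂ) ∂circleMeasure =
      ((∫ s, circlePoisson r (t - s) ∂circleMeasure : ℝ) : ℂ) := by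
    rw [← integral_complex_ofReal]
    simp
  rw [h4] at h3
  exact_mod_cast h3

theorem integrable_circlePoisson_smul {G : Type*} [NormedAddCommGroup G] [NormedSpace ℝ G]
    {f : Torus → G} (hf : Integrable f circleMeasure)
    {r : ℝ} (h0 : 0 ≤ r) (h1 : r < 1) (t : Torus) :
    Integrable (fun s => circlePoisson r (t - s) • f s) circleMeasure := by
  have hc : Continuous fun s => circlePoisson r (t - s) :=
    (continuous_circlePoisson h0 h1).comp (by fun_prop)
  let φ : C(Torus, ℝ) := ⟨_, hc⟩
  exact hf.bdd_smul ‖φ‖ hc.aestronglyMeasurable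
    (Eventually.of_forall fun s => φ.norm_coe_le_norm s)

theorem norm_integral_circlePoisson_le {f : Torus → E} {M : ℝ}
    (hM : ∀ᵐ t ∂circleMeasure, ‖f t‖ ≤ M) {r : ℝ} (h0 : 0 ≤ r) (h1 : r < 1) (t : Torus) :
    ‖∫ s, circlePoisson r (t - s) • f s ∂circleMeasure‖ ≤ M := by
  have hi : Integrable (fun s => circlePoisson r (t - s)) circleMeasure := by
    simpa using integrable_circlePoisson_smul (integrable_const (1 : ℝ)) h0 h1 t
  calc ‖∫ s, circlePoisson r (t - s) • f s ∂circleMeasure‖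
      ≤ ∫ s, circlePoisson r (t - s) * M ∂circleMeasure := by
        refine norm_integral_le_of_norm_le (hi.mul_const M) ?_
        filter_upwards [hM] with s hs
        rw [norm_smul, Real.norm_of_nonneg (circlePoisson_nonneg h0 h1 _)]
        exact mul_le_mul_of_nonneg_left hs (circlePoisson_nonneg h0 h1 _)
    _ = M := by rw [integral_mul_const, integral_circlePoisson h0 h1, one_mul]

/-- **Fatou's theorem** for bounded functions. -/
theorem ae_tendsto_integral_circlePoisson [CompleteSpace E] {f : Torus → E}
    (hf : AEStronglyMeasurable f circleMeasure) {M : ℝ}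
    (hM : ∀ᵐ t ∂circleMeasure, ‖f t‖ ≤ M) :
    ∀ᵐ t ∂circleMeasure, Tendsto (fun r : ℝ =>
      ∫ s, circlePoisson r (t - s) • f s ∂circleMeasure) (𝓝[<] 1) (𝓝 (f t)) := by
  have hfi : Integrable f circleMeasure := Integrable.of_bound hf M hM
  filter_upwards [ae_tendsto_integral_circlePoisson_mul hf hM] with t ht
  rw [tendsto_iff_norm_sub_tendsto_zero]
  refine squeeze_zero' (Eventually.of_forall fun _ => norm_nonneg _) ?_ ht
  have h1 : ∀ᶠ r : ℝ in 𝓝[<] 1, 0 ≤ r :=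
    nhdsWithin_le_nhds (Ici_mem_nhds (by norm_num : (0 : ℝ) < 1))
  filter_upwards [h1, self_mem_nhdsWithin] with r h0 h1
  have e : ∫ s, circlePoisson r (t - s) • f s ∂circleMeasure - f t =
      ∫ s, circlePoisson r (t - s) • (f s - f t) ∂circleMeasure := by
    simp_rw [smul_sub]
    rw [integral_sub (integrable_circlePoisson_smul hfi h0 h1 t)
      (integrable_circlePoisson_smul (integrable_const _) h0 h1 t), integral_smul_const,
      integral_circlePoisson h0 h1, one_smul]
  rw [e]
  refine (norm_integral_le_integral_norm _).trans_eq ?_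
  refine integral_congr_ae (Eventually.of_forall fun s => ?_)
  simp only
  rw [norm_smul, Real.norm_of_nonneg (circlePoisson_nonneg h0 h1 _)]

end Cauchy

/-! ### Taylor coefficients of power series with bounded coefficients. -/

section PowerSeries

variable {G : Type*} [NormedAddCommGroup G] [NormedSpace ℂ G]

/-- The formal power series `∑ a_n z^n`. -/
def coeffSeries (a : ℕ → G) : FormalMultilinearSeries ℂ ℂ G := fun n =>
  ContinuousMultilinearMap.mkPiRing ℂ (Fin n) (a n)

theorem summable_pow_smul [CompleteSpace G] {a : ℕ → G} {C : ℝ} (ha : ∀ n, ‖a n‖ ≤ C) {z : ℂ}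
    (hz : ‖z‖ < 1) : Summable fun n => z ^ n • a n := by
  refine Summable.of_norm_bounded
    ((summable_geometric_of_lt_one (norm_nonneg z) hz).mul_right C) fun n => ?_
  rw [norm_smul, norm_pow]
  gcongr
  exact ha n

theorem hasFPowerSeriesOnBall_tsum [CompleteSpace G] {a : ℕ → G} {C : ℝ} (ha : ∀ n, ‖a n‖ ≤ C) :
    HasFPowerSeriesOnBall (fun z : ℂ => ∑' n, z ^ n • a n) (coeffSeries a) 0 1 where
  r_le := by
    refine (coeffSeries a).le_radius_of_bound C fun n => ?_
    rw [coeffSeries, ContinuousMultilinearMap.norm_mkPiRing]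
    simpa using ha n
  r_pos := one_pos
  hasSum := by
    intro y hy
    have hy' : ‖y‖ < 1 := by
      rw [← ENNReal.ofReal_one, Metric.eball_ofReal] at hy
      simpa using hy
    rw [zero_add]
    convert (summable_pow_smul ha hy').hasSum using 2 with n
    simp [coeffSeries]

theorem iteratedDeriv_tsum_zero [CompleteSpace G] {a : ℕ → G} {C : ℝ} (ha : ∀ n, ‖a n‖ ≤ C)
    (m : ℕ) :
    ((m.factorial : ℂ)⁻¹) • iteratedDeriv m (fun z : ℂ => ∑' n, z ^ n • a n) 0 = a m := by
  have h := (hasFPowerSeriesOnBall_tsum ha).factorial_smul 1 m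
  rw [iteratedDeriv_eq_iteratedFDeriv, ← h]
  simp only [coeffSeries, ContinuousMultilinearMap.mkPiRing_apply, Finset.prod_const_one, one_smul]
  rw [← Nat.cast_smul_eq_nsmul ℂ, smul_smul, inv_mul_cancel₀, one_smul]
  exact_mod_cast m.factorial_ne_zero

end PowerSeries

/-! ### Inner functions built from families of functions of constant norm. -/

section Realization

variable {E F : Type*} [NormedAddCommGroup E] [InnerProductSpace ℂ E]
  [NormedAddCommGroup F] [InnerProductSpace ℂ F]

/-- The `n`-th Fourier coefficient as a bounded operator on `L²_E`. -/
def fourierCoeffL (E : Type*) [NormedAddCommGroup E] [InnerProductSpace ℂ E] (n : ℤ) :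
    L2 E →L[ℂ] E :=
  LinearMap.mkContinuous
    { toFun := fun f => fourierCoeff f n
      map_add' := by
        intro f g
        rw [fourierCoeff_congr_ae (Lp.coeFn_add f g),
          fourierCoeff.add (integrable_L2 E f) (integrable_L2 E g), Pi.add_apply]
      map_smul' := by
        intro c f
        rw [fourierCoeff_congr_ae (Lp.coeFn_smul c f), fourierCoeff.const_smul, RingHom.id_apply] }
    1 (by
      intro f
      have := norm_fourierCoeff_sub_le E f 0 n
      rw [sub_zero, fourierCoeff_congr_ae (Lp.coeFn_zero E 2 circleMeasure)] at this
      have h0 : fourierCoeff (0 : Torus → E) n = 0 := by simp [fourierCoeff]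
      rw [h0, sub_zero] at this
      rw [one_mul]
      exact this)

theorem fourierCoeffL_apply (n : ℤ) (f : L2 E) : fourierCoeffL E n f = fourierCoeff f n := rfl

theorem norm_fourierCoeffL_le (n : ℤ) : ‖fourierCoeffL E n‖ ≤ 1 :=
  LinearMap.mkContinuous_norm_le _ zero_le_one _

theorem exists_eq_real_mul_toCircle (z : ℂ) :
    ∃ t : Torus, z = (‖z‖ : ℂ) * AddCircle.toCircle t := by
  refine ⟨(z.arg : Torus), ?_⟩
  have h : (AddCircle.toCircle (z.arg : Torus) : ℂ) = Complex.exp (z.arg * Complex.I) := by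
    rw [AddCircle.toCircle_apply_mk, Circle.coe_exp]
    congr 2
    have := Real.two_pi_pos.ne'
    field_simp
  rw [h, Complex.norm_mul_exp_arg_mul_I]

/-- Equicontinuity carries convergence from a dense set to every vector. This produces strong radial
limits at a point `t` from radial limits on a countable dense set of vectors. -/
theorem tendsto_of_dense_of_norm_le {A : ℝ → F →L[ℂ] E} [CompleteSpace E] {l : Filter ℝ} [l.NeBot]
    (hA : ∀ᶠ r in l, ∀ x, ‖A r x‖ ≤ ‖x‖) {D : Set F} (hD : Dense D)
    (h : ∀ x ∈ D, ∃ y, Tendsto (fun r => A r x) l (𝓝 y)) (x : F) :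
    ∃ y, Tendsto (fun r => A r x) l (𝓝 y) := by
  refine cauchy_map_iff_exists_tendsto.1 ?_
  rw [Metric.cauchy_iff]
  refine ⟨inferInstance, fun ε hε => ?_⟩
  obtain ⟨d, hdD, hd⟩ := hD.exists_dist_lt x (by positivity : 0 < ε / 4)
  obtain ⟨y, hy⟩ := h d hdD
  have hev := hA.and (Metric.tendsto_nhds.1 hy (ε / 4) (by positivity))
  refine ⟨_, Filter.image_mem_map hev, ?_⟩
  have key : ∀ r, (∀ x, ‖A r x‖ ≤ ‖x‖) ∧ dist (A r d) y < ε / 4 → dist (A r x) y < ε / 2 := by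
    intro r hr
    have h1 : dist (A r x) (A r d) ≤ dist x d := by
      rw [dist_eq_norm, dist_eq_norm, ← map_sub]
      exact hr.1 _
    linarith [dist_triangle (A r x) (A r d) y, hr.2]
  rintro _ ⟨r, hr, rfl⟩ _ ⟨r', hr', rfl⟩
  linarith [key r hr, key r' hr', dist_triangle_right (A r x) (A r' x) y]

/-- A bounded operator `V` from `F` to `H²_E` such that every `V c` has constant norm `‖c‖` on the
circle is given by an inner function. -/
theorem exists_isInner [CompleteSpace E] [CompleteSpace F] [TopologicalSpace.SeparableSpace F]
    (V : F →L[ℂ] H2 E) (hV : ∀ c, ∀ᵐ t ∂circleMeasure, ‖(V c : L2 E) t‖ = ‖c‖) :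
    ∃ Θ : ℂ → F →L[ℂ] E, IsInner Θ ∧
      (∀ (m : ℕ) c, taylorCoeff Θ m c = fourierCoeff (V c : L2 E) m) ∧
      ∀ c, ∀ᵐ t ∂circleMeasure, boundaryValue Θ t c = (V c : L2 E) t := by
  let ψ : ℕ → F →L[ℂ] E := fun n => fourierCoeffL E n ∘L (H2 E).subtypeL ∘L V
  have hψ : ∀ n, ‖ψ n‖ ≤ ‖(H2 E).subtypeL ∘L V‖ := fun n =>
    (ContinuousLinearMap.opNorm_comp_le _ _).trans
      (mul_le_of_le_one_left (norm_nonneg _) (norm_fourierCoeffL_le _))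
  let Θ : ℂ → F →L[ℂ] E := fun z => ∑' n, z ^ n • ψ n
  have hval : ∀ (r : ℝ), 0 ≤ r → r < 1 → ∀ (t : Torus) (c : F),
      Θ ((r : ℂ) * AddCircle.toCircle t) c =
        ∫ s, circlePoisson r (t - s) • (V c : L2 E) s ∂circleMeasure := by
    intro r h0 h1 t c
    have hz : ‖(r : ℂ) * AddCircle.toCircle t‖ < 1 := by
      rwa [← fourier_one, norm_real_mul_fourier h0]
    have hs := (summable_pow_smul hψ hz).hasSum
    have hs2 := (ContinuousLinearMap.apply ℂ E c).hasSum hs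
    refine hs2.unique ?_
    exact hasSum_integral_circlePoisson (integrable_L2 E _) (V c).2 h0 h1 t
  have hbound : ∀ c, ∀ᵐ t ∂circleMeasure, ‖(V c : L2 E) t‖ ≤ ‖c‖ := fun c => by
    filter_upwards [hV c] with t ht using ht.le
  have hcontr : ∀ z ∈ Metric.ball (0 : ℂ) 1, ∀ c, ‖Θ z c‖ ≤ ‖c‖ := by
    intro z hz c
    obtain ⟨t, ht⟩ := exists_eq_real_mul_toCircle z
    rw [mem_ball_zero_iff] at hz
    rw [ht, hval _ (norm_nonneg z) hz]
    exact norm_integral_circlePoisson_le (hbound c) (norm_nonneg z) hz t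
  have hrad : ∀ c, ∀ᵐ t ∂circleMeasure, Tendsto
      (fun r : ℝ => Θ ((r : ℂ) * AddCircle.toCircle t) c) (𝓝[<] 1) (𝓝 ((V c : L2 E) t)) := by
    intro c
    filter_upwards [ae_tendsto_integral_circlePoisson
      (Lp.aestronglyMeasurable (V c : L2 E)) (hbound c)] with t ht
    refine ht.congr' ?_
    have h1 : ∀ᶠ r : ℝ in 𝓝[<] 1, 0 ≤ r :=
      nhdsWithin_le_nhds (Ici_mem_nhds (by norm_num : (0 : ℝ) < 1))
    filter_upwards [h1, self_mem_nhdsWithin] with r h0 h1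
    exact (hval r h0 h1 t c).symm
  have hinner : IsInner Θ := by
    refine ⟨⟨?_, hcontr⟩, ?_⟩
    · have := (hasFPowerSeriesOnBall_tsum hψ).differentiableOn
      rwa [← ENNReal.ofReal_one, Metric.eball_ofReal] at this
    -- The null set in `hrad` and `hV` depends on the vector, so only countably many vectors are
    -- used; contractivity and continuity recover the others.
    · have hD := (ae_all_iff (ι := ℕ)).2 fun n => (hrad (TopologicalSpace.denseSeq F n)).and
        (hV (TopologicalSpace.denseSeq F n))
      filter_upwards [hD] with t ht
      have hev : ∀ᶠ r : ℝ in 𝓝[<] 1, ∀ x, ‖Θ ((r : ℂ) * AddCircle.toCircle t) x‖ ≤ ‖x‖ := by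
        have h1 : ∀ᶠ r : ℝ in 𝓝[<] 1, 0 ≤ r :=
          nhdsWithin_le_nhds (Ici_mem_nhds (by norm_num : (0 : ℝ) < 1))
        filter_upwards [h1, self_mem_nhdsWithin] with r h0 h1
        refine hcontr _ ?_
        rw [mem_ball_zero_iff, ← fourier_one, norm_real_mul_fourier h0]
        exact h1
      have hex := tendsto_of_dense_of_norm_le (l := 𝓝[<] (1 : ℝ)) hev
        (TopologicalSpace.denseRange_denseSeq F)
        (by rintro _ ⟨n, rfl⟩; exact ⟨_, (ht n).1⟩)
      choose a ha using hex
      let A : F →L[ℂ] E := continuousLinearMapOfTendsto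
        (fun r : ℝ => Θ ((r : ℂ) * AddCircle.toCircle t)) (tendsto_pi_nhds.2 ha)
      have hA : HasRadialLimit Θ t A := ha
      refine ⟨A, hA, fun x => ?_⟩
      refine congrFun ((TopologicalSpace.denseRange_denseSeq F).equalizer
        (by fun_prop) (by fun_prop) (funext fun n => ?_) :
          (fun x => ‖A x‖) = fun x => ‖x‖) x
      simp only [Function.comp_apply]
      rw [tendsto_nhds_unique (hA _) (ht n).1, (ht n).2]
  refine ⟨Θ, hinner, fun m c => ?_, fun c => ?_⟩
  · have : taylorCoeff Θ m = ψ m := iteratedDeriv_tsum_zero hψ m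
    rw [this]
    rfl
  · filter_upwards [hinner.isometry_boundaryValue, hrad c] with t h1 h2
    exact tendsto_nhds_unique (h1.1 c) h2

end Realization

/-! ### Toeplitz operators of inner functions are isometries commuting with the shift. -/

section InnerToeplitz

variable {E F : Type*} [NormedAddCommGroup E] [InnerProductSpace ℂ E]
  [NormedAddCommGroup F] [InnerProductSpace ℂ F]

theorem laurent_mulFourier (Φ : LInfty E F) (n : ℤ) (f : L2 E) :
    laurent Φ (mulFourier n f) = mulFourier n (laurent Φ f) := by
  refine Lp.ext ?_
  filter_upwards [coeFn_laurent Φ (mulFourier n f), coeFn_mulFourier n f,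
    coeFn_mulFourier n (laurent Φ f), coeFn_laurent Φ f] with t h1 h2 h3 h4
  rw [h1, h2, h3, h4, map_smul]

/-- Cauchy's theorem for `z^k g(z)` on the circle of radius `r`, where `n = -(k + 1)`: the remaining
factor `e^{it}` comes from `dz`. -/
theorem fourierCoeff_circle_eq_zero {g : ℂ → E} (hg : DifferentiableOn ℂ g (Metric.ball 0 1))
    {r : ℝ} (h0 : 0 < r) (h1 : r < 1) {n : ℤ} (hn : n < 0) :
    fourierCoeff (fun t : Torus => g ((r : ℂ) * AddCircle.toCircle t)) n = 0 := by
  obtain ⟨k, rfl⟩ : ∃ k : ℕ, n = -(k + 1 : ℤ) := ⟨(-n - 1).toNat, by omega⟩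
  have hz : (∮ z in C(0, r), z ^ k • g z) = 0 := by
    refine DiffContOnCl.circleIntegral_eq_zero h0.le ?_
    refine DifferentiableOn.diffContOnCl ?_
    refine DifferentiableOn.smul (by fun_prop) (hg.mono ?_)
    refine Metric.closure_ball_subset_closedBall.trans (Metric.closedBall_subset_ball h1)
  rw [fourierCoeff_eq_intervalIntegral _ _ 0, zero_add]
  rw [circleIntegral] at hz
  have e : ∀ x : ℝ, deriv (circleMap 0 r) x • (circleMap 0 r x ^ k • g (circleMap 0 r x)) =
      ((r : ℂ) ^ (k + 1) * Complex.I) • (fourier (-(-(k + 1 : ℤ))) (x : Torus) •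
        g ((r : ℂ) * AddCircle.toCircle (x : Torus))) := by
    intro x
    have hc : circleMap 0 r x = (r : ℂ) * AddCircle.toCircle (x : Torus) := by
      rw [circleMap_zero, AddCircle.toCircle_apply_mk, Circle.coe_exp]
      congr 4
      have := Real.two_pi_pos.ne'
      field_simp
    have hp : (fourier (-(-(k + 1 : ℤ))) (x : Torus) : ℂ) =
        (AddCircle.toCircle (x : Torus) : ℂ) ^ (k + 1) := by
      rw [← fourier_one, fourier_pow]
      congr 2
      push_cast
      ring
    rw [deriv_circleMap, hp, smul_smul, smul_smul, hc]
    congr 1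
    ring
  simp_rw [e] at hz
  rw [intervalIntegral.integral_smul, smul_eq_zero] at hz
  rcases hz with hz | hz
  · have : (r : ℂ) ≠ 0 := by exact_mod_cast h0.ne'
    simp [this] at hz
  · rw [hz, smul_zero]

/-- The coefficient vanishes on every circle of radius `ρ k < 1`; contractivity of `Θ` gives the
bound `‖c‖` under which the limit `ρ k → 1` passes through the integral. -/
theorem IsInner.fourierCoeff_boundaryValue_eq_zero {Θ : ℂ → F →L[ℂ] E} (hΘ : IsInner Θ) (c : F)
    {n : ℤ} (hn : n < 0) : fourierCoeff (fun t => boundaryValue Θ t c) n = 0 := by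
  let ρ : ℕ → ℝ := fun k => 1 - 1 / ((k : ℝ) + 2)
  have hpos : ∀ k : ℕ, 0 < 1 / ((k : ℝ) + 2) := fun k => by positivity
  have hρ0 : ∀ k, 0 < ρ k := fun k => by
    have : 1 / ((k : ℝ) + 2) < 1 := by
      rw [div_lt_one (by positivity)]
      linarith [(Nat.cast_nonneg k : (0 : ℝ) ≤ k)]
    simp only [ρ]
    linarith
  have hρ1 : ∀ k, ρ k < 1 := fun k => by
    simp only [ρ]
    linarith [hpos k]
  have hlim : Tendsto ρ atTop (𝓝[<] 1) := by
    refine tendsto_nhdsWithin_iff.2 ⟨?_, Eventually.of_forall hρ1⟩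
    have h := (tendsto_one_div_add_atTop_nhds_zero_nat (𝕜 := ℝ)).comp (tendsto_add_atTop_nat 1)
    have h2 := h.const_sub 1
    rw [sub_zero] at h2
    refine h2.congr fun k => ?_
    simp only [ρ, Function.comp_apply]
    push_cast
    ring_nf
  have hmem : ∀ k (t : Torus), ((ρ k : ℝ) : ℂ) * AddCircle.toCircle t ∈ Metric.ball (0 : ℂ) 1 := by
    intro k t
    rw [mem_ball_zero_iff, ← fourier_one, norm_real_mul_fourier (hρ0 k).le]
    exact hρ1 k
  have hdiff : DifferentiableOn ℂ (fun z => Θ z c) (Metric.ball 0 1) :=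
    hΘ.differentiableOn.clm_apply (differentiableOn_const c)
  have hT := tendsto_integral_of_dominated_convergence (μ := circleMeasure)
    (F := fun k (t : Torus) => fourier (-n) t • Θ (((ρ k : ℝ) : ℂ) * AddCircle.toCircle t) c)
    (f := fun t => fourier (-n) t • boundaryValue Θ t c) (fun _ => ‖c‖)
    (fun k => Continuous.aestronglyMeasurable (by
      refine Continuous.smul (by fun_prop) ?_
      exact hdiff.continuousOn.comp_continuous
        (continuous_const.mul (continuous_subtype_val.comp AddCircle.continuous_toCircle))
        (hmem k)))
    (integrable_const _)
    (fun k => Eventually.of_forall fun t => by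
      rw [norm_smul, norm_fourier_apply, one_mul]
      exact hΘ.contractive _ (hmem k t) c)
    (by
      filter_upwards [hΘ.isometry_boundaryValue] with t ht
      exact ((ht.1 c).comp hlim).const_smul _)
  have hzero : ∀ k, ∫ t, fourier (-n) t • Θ (((ρ k : ℝ) : ℂ) * AddCircle.toCircle t) c
      ∂circleMeasure = 0 := fun k => fourierCoeff_circle_eq_zero hdiff (hρ0 k) (hρ1 k) hn
  simp_rw [hzero] at hT
  exact tendsto_nhds_unique hT tendsto_const_nhds |>.symm ▸ rfl

theorem IsInner.coeFn_laurent_monomial_zero {Θ : ℂ → F →L[ℂ] E} (hΘ : IsInner Θ) (c : F) :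
    (laurent hΘ.symbol (monomial 0 c) : Torus → E) =ᵐ[circleMeasure]
      fun t => boundaryValue Θ t c := by
  filter_upwards [coeFn_laurent hΘ.symbol (monomial 0 c), coeFn_monomial 0 c] with t h1 h2
  rw [h1, h2, fourier_zero, one_smul]
  rfl

variable [CompleteSpace F] [TopologicalSpace.SeparableSpace F]

/-- `H²_E` is closed and shift-invariant and multiplication by the symbol commutes with `z`, so only
constants need checking. Hence the projection in `toeplitz` acts trivially. -/
theorem IsInner.laurent_mem_H2 {Θ : ℂ → F →L[ℂ] E} (hΘ : IsInner Θ) (h : H2 F) :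
    laurent hΘ.symbol (h : L2 F) ∈ H2 E := by
  let M : Submodule ℂ (H2 F) :=
    (H2 E).comap ((laurent hΘ.symbol ∘L (H2 F).subtypeL : H2 F →L[ℂ] L2 E) : H2 F →ₗ[ℂ] L2 E)
  have hM : IsClosed (M : Set (H2 F)) :=
    (isClosed_H2 E).preimage (laurent hΘ.symbol ∘L (H2 F).subtypeL).continuous
  have htop : M = ⊤ := by
    refine eq_top_of_hardyMonomial_mem hM fun k c => ?_
    change laurent hΘ.symbol (monomial k c) ∈ H2 E
    have : monomial (k : ℤ) c = mulFourier k (monomial 0 c) := by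
      rw [mulFourier_monomial, add_zero]
    rw [this, laurent_mulFourier]
    refine mulFourier_mem_H2 k fun n hn => ?_
    have := fourierCoeff_congr_ae (hΘ.coeFn_laurent_monomial_zero c)
    exact (congrFun this n).trans (hΘ.fourierCoeff_boundaryValue_eq_zero c hn)
  exact (htop ▸ Submodule.mem_top : h ∈ M)

variable [CompleteSpace E]

theorem IsInner.coe_toeplitz {Θ : ℂ → F →L[ℂ] E} (hΘ : IsInner Θ) (h : H2 F) :
    (toeplitz hΘ.symbol h : L2 E) = laurent hΘ.symbol (h : L2 F) :=
  Submodule.starProjection_eq_self_iff.2 (hΘ.laurent_mem_H2 h)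

theorem IsInner.norm_toeplitz {Θ : ℂ → F →L[ℂ] E} (hΘ : IsInner Θ) (h : H2 F) :
    ‖toeplitz hΘ.symbol h‖ = ‖h‖ := by
  change ‖(toeplitz hΘ.symbol h : L2 E)‖ = ‖(h : L2 F)‖
  rw [hΘ.coe_toeplitz, Lp.norm_def, Lp.norm_def]
  congr 1
  refine eLpNorm_congr_norm_ae ?_
  filter_upwards [coeFn_laurent hΘ.symbol (h : L2 F), hΘ.isometry_boundaryValue] with t h1 h2
  rw [h1]
  exact h2.2 _

theorem IsInner.toeplitz_shift {Θ : ℂ → F →L[ℂ] E} (hΘ : IsInner Θ) (h : H2 F) :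
    toeplitz hΘ.symbol (shift h) = shift (toeplitz hΘ.symbol h) := by
  refine Subtype.ext ?_
  rw [hΘ.coe_toeplitz, coe_shift, coe_shift, laurent_mulFourier, hΘ.coe_toeplitz]

end InnerToeplitz

/-! ### Partial isometries between Hilbert spaces. -/

section PartialIsometry

variable {H K L : Type*} [NormedAddCommGroup H] [InnerProductSpace ℂ H]
  [NormedAddCommGroup K] [InnerProductSpace ℂ K]
  [NormedAddCommGroup L] [InnerProductSpace ℂ L]

/-- The initial space of a bounded operator. -/
abbrev initialSpace (T : H →L[ℂ] K) : Submodule ℂ H := (LinearMap.ker (T : H →ₗ[ℂ] K))ᗮ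

theorem norm_sq_of_initialSpace {T : H →L[ℂ] K} {k n : H} (hk : T k = 0)
    (hn : n ∈ initialSpace T) : ‖k + n‖ ^ 2 = ‖k‖ ^ 2 + ‖n‖ ^ 2 := by
  have h : ⟪k, n⟫_ℂ = 0 := hn k hk
  rw [sq, sq, sq]
  exact norm_add_sq_eq_norm_sq_add_norm_sq_of_inner_eq_zero k n h

theorem IsPartialIsometry.inner_map_map {T : H →L[ℂ] K} (hT : IsPartialIsometry T) {x y : H}
    (hx : x ∈ initialSpace T) (hy : y ∈ initialSpace T) : ⟪T x, T y⟫_ℂ = ⟪x, y⟫_ℂ := by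
  let U : initialSpace T →ₗᵢ[ℂ] K :=
    ⟨(T : H →ₗ[ℂ] K) ∘ₗ (initialSpace T).subtype, fun z => hT z z.2⟩
  exact U.inner_map_map ⟨x, hx⟩ ⟨y, hy⟩

variable [CompleteSpace H]

theorem exists_add_of_initialSpace (T : H →L[ℂ] K) (x : H) :
    ∃ k n : H, T k = 0 ∧ n ∈ initialSpace T ∧ x = k + n := by
  have : CompleteSpace (LinearMap.ker (T : H →ₗ[ℂ] K)) := T.isClosed_ker.completeSpace_coe
  obtain ⟨k, hk, n, hn, h⟩ := (LinearMap.ker (T : H →ₗ[ℂ] K)).exists_add_mem_mem_orthogonal x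
  exact ⟨k, n, hk, hn, h⟩

/-- By Pythagoras, a kernel component would add to `‖x‖` without adding to `‖T x‖`. -/
theorem IsPartialIsometry.mem_initialSpace {T : H →L[ℂ] K} (hT : IsPartialIsometry T) {x : H}
    (h : ‖x‖ ≤ ‖T x‖) : x ∈ initialSpace T := by
  obtain ⟨k, n, hk, hn, rfl⟩ := exists_add_of_initialSpace T x
  rw [map_add, hk, zero_add, hT n hn] at h
  have h1 := norm_sq_of_initialSpace hk hn
  have h2 : ‖k + n‖ ^ 2 ≤ ‖n‖ ^ 2 := by gcongr
  have h3 : ‖k‖ ^ 2 = 0 := le_antisymm (by linarith) (sq_nonneg _)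
  rw [norm_eq_zero.1 (pow_eq_zero_iff two_ne_zero |>.1 h3), zero_add]
  exact hn

/-- `A B^*` is a partial isometry if `A` and `B` are isometries. -/
theorem isPartialIsometry_comp_adjoint [CompleteSpace L] {A : L →L[ℂ] K} {B : L →L[ℂ] H}
    (hA : ∀ x, ‖A x‖ = ‖x‖) (hB : ∀ x, ‖B x‖ = ‖x‖) :
    IsPartialIsometry (A ∘L ContinuousLinearMap.adjoint B) := by
  intro h hh
  have hBB := (ContinuousLinearMap.norm_map_iff_adjoint_comp_self B).1 hB
  have hBB' : ∀ y, ContinuousLinearMap.adjoint B (B y) = y := fun y =>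
    congrArg (fun f : L →L[ℂ] L => f y) hBB
  -- `h - B B* h` is killed by `B*`, hence lies in the kernel, to which `h` is orthogonal; so `‖h‖²
  -- = ‖B* h‖²`.
  have hk : ⟪h - B (ContinuousLinearMap.adjoint B h), h⟫_ℂ = 0 := by
    refine hh _ ?_
    rw [LinearMap.mem_ker]
    change A (ContinuousLinearMap.adjoint B (h - B (ContinuousLinearMap.adjoint B h))) = 0
    rw [map_sub, hBB', sub_self, map_zero]
  rw [inner_sub_left, sub_eq_zero, ← ContinuousLinearMap.adjoint_inner_right] at hk
  rw [ContinuousLinearMap.comp_apply, hA, @norm_eq_sqrt_re_inner ℂ, ← hk,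
    ← @norm_eq_sqrt_re_inner ℂ]

end PartialIsometry

/-! ### The initial space of a partially isometric Toeplitz operator is shift-invariant. -/

section Toeplitz

variable {E F : Type*} [NormedAddCommGroup E] [InnerProductSpace ℂ E]
  [NormedAddCommGroup F] [InnerProductSpace ℂ F] [CompleteSpace F]

theorem inner_toeplitz_right (Φ : LInfty E F) (g : H2 F) (h : H2 E) :
    ⟪g, toeplitz Φ h⟫_ℂ = ⟪(g : L2 F), laurent Φ (h : L2 E)⟫_ℂ :=
  (H2 F).inner_orthogonalProjectionOnto_eq_of_mem_left g _

/-- Toeplitz operators satisfy `S^* T_Φ S = T_Φ`. -/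
theorem inner_shift_toeplitz_shift (Φ : LInfty E F) (g : H2 F) (h : H2 E) :
    ⟪shift g, toeplitz Φ (shift h)⟫_ℂ = ⟪g, toeplitz Φ h⟫_ℂ := by
  rw [inner_toeplitz_right, inner_toeplitz_right, coe_shift, coe_shift, laurent_mulFourier,
    inner_mulFourier_mulFourier]

variable [CompleteSpace E]

/-- Equality in Cauchy–Schwarz. The inner product `hin` equals `‖h‖²`, so `T S h` has norm at least
`‖h‖ = ‖S h‖`, which puts `S h` in the initial space; then expanding `‖S T h - T S h‖²` gives `0`.
-/
theorem IsPartialIsometry.shift_mem_initialSpace_and_eq {Φ : LInfty E F}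
    (hT : IsPartialIsometry (toeplitz Φ)) {h : H2 E} (hh : h ∈ initialSpace (toeplitz Φ)) :
    shift h ∈ initialSpace (toeplitz Φ) ∧ toeplitz Φ (shift h) = shift (toeplitz Φ h) := by
  have hin : ⟪shift (toeplitz Φ h), toeplitz Φ (shift h)⟫_ℂ = (‖h‖ : ℂ) ^ 2 := by
    rw [inner_shift_toeplitz_shift, ← hT h hh]
    exact inner_self_eq_norm_sq_to_K (𝕜 := ℂ) (toeplitz Φ h)
  have hle : ‖h‖ ≤ ‖toeplitz Φ (shift h)‖ := by
    rcases eq_or_lt_of_le (norm_nonneg h) with h0 | h0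
    · rw [← h0]
      exact norm_nonneg _
    · have := norm_inner_le_norm (𝕜 := ℂ) (shift (toeplitz Φ h)) (toeplitz Φ (shift h))
      rw [hin, norm_shift, hT h hh, norm_pow, Complex.norm_real, norm_norm, sq] at this
      exact le_of_mul_le_mul_left this h0
  have hmem : shift h ∈ initialSpace (toeplitz Φ) :=
    hT.mem_initialSpace (by rwa [norm_shift])
  refine ⟨hmem, ?_⟩
  have hsub := @norm_sub_sq ℂ _ _ _ _ (shift (toeplitz Φ h)) (toeplitz Φ (shift h))
  rw [hin, norm_shift, hT h hh, hT _ hmem, norm_shift] at hsub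
  have hre : RCLike.re ((‖h‖ : ℂ) ^ 2) = ‖h‖ ^ 2 := by
    rw [← Complex.ofReal_pow]
    exact Complex.ofReal_re _
  rw [hre] at hsub
  have h0 : ‖shift (toeplitz Φ h) - toeplitz Φ (shift h)‖ ^ 2 = 0 := by linarith
  exact (sub_eq_zero.1 (norm_eq_zero.1 (pow_eq_zero_iff two_ne_zero |>.1 h0))).symm

theorem IsPartialIsometry.shift_iterate_mem_and_eq {Φ : LInfty E F}
    (hT : IsPartialIsometry (toeplitz Φ)) {h : H2 E} (hh : h ∈ initialSpace (toeplitz Φ)) (n : ℕ) :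
    shift^[n] h ∈ initialSpace (toeplitz Φ) ∧
      toeplitz Φ (shift^[n] h) = shift^[n] (toeplitz Φ h) := by
  induction n with
  | zero => exact ⟨hh, rfl⟩
  | succ n ih =>
    have := hT.shift_mem_initialSpace_and_eq ih.1
    rw [Function.iterate_succ_apply', Function.iterate_succ_apply', this.2, ih.2]
    exact ⟨this.1, rfl⟩

end Toeplitz

/-! ### Wandering subspaces and the Wold decomposition inside `H²`. -/

section Wandering

variable {E : Type*} [NormedAddCommGroup E] [InnerProductSpace ℂ E]

/-- The shift as a linear isometry. -/
def shiftIsometry (E : Type*) [NormedAddCommGroup E] [InnerProductSpace ℂ E] : H2 E →ₗᵢ[ℂ] H2 E :=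
  { toLinearMap := (shift : H2 E →L[ℂ] H2 E).toLinearMap
    norm_map' := fun f => norm_shift f }

/-- The wandering subspace `N ⊖ S N`. -/
def wandering (N : Submodule ℂ (H2 E)) : Submodule ℂ (H2 E) :=
  N ⊓ (N.map (shiftIsometry E).toLinearMap)ᗮ

theorem inner_shift_of_mem_wandering {N : Submodule ℂ (H2 E)} {c g : H2 E} (hc : c ∈ wandering N)
    (hg : g ∈ N) : ⟪shift g, c⟫_ℂ = 0 :=
  hc.2 _ (Submodule.mem_map_of_mem hg)

theorem isClosed_wandering {N : Submodule ℂ (H2 E)} (hN : IsClosed (N : Set (H2 E))) :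
    IsClosed (wandering N : Set (H2 E)) :=
  hN.inter (Submodule.isClosed_orthogonal _)

variable [CompleteSpace E] [TopologicalSpace.SeparableSpace E]

/-- A vector of a shift-invariant subspace `N` orthogonal to `S^n (N ⊖ S N)` for all `n`
vanishes. -/
theorem eq_zero_of_inner_wandering_eq_zero {N : Submodule ℂ (H2 E)}
    (hN : IsClosed (N : Set (H2 E))) (hS : ∀ g ∈ N, shift g ∈ N) {g : H2 E} (hg : g ∈ N)
    (h : ∀ c ∈ wandering N, ∀ n : ℕ, ⟪shift^[n] c, g⟫_ℂ = 0) : g = 0 := by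
  have : CompleteSpace N := hN.completeSpace_coe
  let M := N.map (shiftIsometry E).toLinearMap
  -- The shift being isometric, `S N` is complete and the orthogonal splitting along it exists.
  have : CompleteSpace M := (shiftIsometry E).completeSpace_map N
  have hMN : M ≤ N := by
    rintro _ ⟨x, hx, rfl⟩
    exact hS x hx
  -- Split `g` along `S N`. The other component lies in `wandering N`, and the case `n = 0` makes it
  -- orthogonal to itself; so `g = S g'`, and cancelling one shift passes the hypothesis on to `g'`.
  have step : ∀ g ∈ N, (∀ c ∈ wandering N, ∀ n : ℕ, ⟪shift^[n] c, g⟫_ℂ = 0) →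
      ∃ g' ∈ N, (∀ c ∈ wandering N, ∀ n : ℕ, ⟪shift^[n] c, g'⟫_ℂ = 0) ∧ g = shift g' := by
    intro g hg h
    obtain ⟨m, hm, c, hc, e⟩ := M.exists_add_mem_mem_orthogonal g
    have hcN : c ∈ wandering N := by
      refine ⟨?_, hc⟩
      rw [eq_sub_of_add_eq' e.symm]
      exact N.sub_mem hg (hMN hm)
    have h0 : ⟪c, c⟫_ℂ = 0 := by
      have := h c hcN 0
      rw [e, Function.iterate_zero, id_eq, inner_add_right, ← inner_conj_symm, hc m hm, map_zero,
        zero_add] at this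
      exact this
    rw [(inner_self_eq_zero (𝕜 := ℂ) (x := c)).1 h0, add_zero] at e
    obtain ⟨g', hg', rfl⟩ := hm
    refine ⟨g', hg', fun c hc n => ?_, e⟩
    rw [← inner_shift_shift, ← Function.iterate_succ_apply' shift]
    have := h c hc (n + 1)
    rwa [e] at this
  -- Repeating `step`, `g` is divisible by every power of `z`. The induction must range over all
  -- `g`, since each step replaces `g` by `g'`.
  have key : ∀ n : ℕ, ∀ g ∈ N, (∀ c ∈ wandering N, ∀ n : ℕ, ⟪shift^[n] c, g⟫_ℂ = 0) →
      fourierCoeff (g : L2 E) n = 0 := by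
    intro n
    induction n with
    | zero =>
      intro g hg h
      obtain ⟨g', -, -, rfl⟩ := step g hg h
      rw [fourierCoeff_shift]
      exact g'.2 _ (by norm_num)
    | succ n ih =>
      intro g hg h
      obtain ⟨g', hg', h', rfl⟩ := step g hg h
      rw [fourierCoeff_shift, ← ih g' hg' h']
      congr 1
      push_cast
      ring
  refine H2_ext_fourierCoeff fun n => ?_
  rw [key n g hg h, ← fourierCoeffL_apply, Submodule.coe_zero, map_zero]

end Wandering

/-! ### From wandering vectors to inner functions, and the coefficient relations. -/

section Factorization

variable {E F G : Type*} [NormedAddCommGroup E] [InnerProductSpace ℂ E] [CompleteSpace E]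
  [NormedAddCommGroup F] [InnerProductSpace ℂ F] [CompleteSpace F]
  [TopologicalSpace.SeparableSpace F]
  [NormedAddCommGroup G] [InnerProductSpace ℂ G] [CompleteSpace G]

/-- A bounded operator `V` from `F` to `H²_E` such that `‖V c‖ = ‖c‖` and `V c ⟂ z^n V c` for
`n ≥ 1` is given by an inner function `Θ` with `V c = Θ c`. -/
theorem exists_isInner_of_wandering (V : F →L[ℂ] H2 E) (hV : ∀ c, ‖V c‖ = ‖c‖)
    (horth : ∀ c (n : ℕ), ⟪V c, shift^[n + 1] (V c)⟫_ℂ = 0) :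
    ∃ (Θ : ℂ → F →L[ℂ] E) (hΘ : IsInner Θ),
      (∀ (m : ℕ) c, taylorCoeff Θ m c = fourierCoeff (V c : L2 E) m) ∧
      ∀ c, toeplitz hΘ.symbol (hardyMonomial 0 c) = V c := by
  obtain ⟨Θ, hΘ, h1, h2⟩ := exists_isInner V fun c => by
    have := ae_norm_eq_of_inner_mulFourier_eq_zero (V c : L2 E) fun n => by
      have := horth c n
      rw [Submodule.coe_inner, coe_shift_iterate] at this
      exact_mod_cast this
    filter_upwards [this] with t ht
    rw [ht]
    exact hV c
  refine ⟨Θ, hΘ, h1, fun c => Subtype.ext (Lp.ext ?_)⟩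
  rw [hΘ.coe_toeplitz]
  filter_upwards [hΘ.coeFn_laurent_monomial_zero c, h2 c] with t h3 h4
  rw [← h4, ← h3]
  rfl

theorem IsInner.toeplitz_shift_iterate {Θ : ℂ → F →L[ℂ] E} (hΘ : IsInner Θ) (n : ℕ) (h : H2 F) :
    toeplitz hΘ.symbol (shift^[n] h) = shift^[n] (toeplitz hΘ.symbol h) := by
  induction n with
  | zero => rfl
  | succ n ih =>
    rw [Function.iterate_succ_apply', Function.iterate_succ_apply', hΘ.toeplitz_shift, ih]

/-- If `T_Θ T_Ψ^*` is a Toeplitz operator, then `θ_m ψ_n^* = 0` for all `m, n ≥ 1`. -/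
theorem taylorCoeff_comp_adjoint_eq_zero {Φ : LInfty E G} {Θ : ℂ → F →L[ℂ] G} {Ψ : ℂ → F →L[ℂ] E}
    (hΘ : IsInner Θ) (hΨ : IsInner Ψ)
    (hθ : ∀ (m : ℕ) c, taylorCoeff Θ m c =
      fourierCoeff (toeplitz hΘ.symbol (hardyMonomial 0 c) : L2 G) m)
    (hψ : ∀ (m : ℕ) c, taylorCoeff Ψ m c =
      fourierCoeff (toeplitz hΨ.symbol (hardyMonomial 0 c) : L2 E) m)
    (hT : toeplitz Φ =
      toeplitz hΘ.symbol ∘L ContinuousLinearMap.adjoint (toeplitz hΨ.symbol))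
    (m n : ℕ) (hm : 1 ≤ m) (hn : 1 ≤ n) :
    taylorCoeff Θ m ∘L ContinuousLinearMap.adjoint (taylorCoeff Ψ n) = 0 := by
  obtain ⟨k, rfl⟩ : ∃ k, n = k + 1 := ⟨n - 1, by omega⟩
  obtain ⟨j, rfl⟩ : ∃ j, m = j + 1 := ⟨m - 1, by omega⟩
  have hTapp : ∀ h, toeplitz hΘ.symbol (ContinuousLinearMap.adjoint (toeplitz hΨ.symbol) h) =
      toeplitz Φ h := fun h => by rw [hT]; rfl
  ext1 x
  set A := toeplitz hΘ.symbol with hA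
  set B := toeplitz hΨ.symbol with hB
  set g : H2 E := hardyMonomial k x with hg
  -- The commutator of `B*` with the shift. Since `B` commutes with the isometric shift, `u` is
  -- orthogonal to every `S v`, that is, constant.
  set u : H2 F := ContinuousLinearMap.adjoint B (shift g) -
    shift (ContinuousLinearMap.adjoint B g) with hu
  have hu0 : ∀ v, ⟪shift v, u⟫_ℂ = 0 := by
    intro v
    rw [hu, inner_sub_right, inner_shift_shift, ContinuousLinearMap.adjoint_inner_right,
      ContinuousLinearMap.adjoint_inner_right, hB, hΨ.toeplitz_shift, inner_shift_shift, sub_self]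
  -- `A u = T_Φ S g - S T_Φ g`, and `S* T_Φ S = T_Φ` makes this orthogonal to the range of the
  -- shift. This is the only place where `A B*` being Toeplitz enters.
  have hAu0 : ∀ v, ⟪shift v, A u⟫_ℂ = 0 := by
    intro v
    rw [hu, map_sub, hA, hΘ.toeplitz_shift, ← hA, hTapp, hTapp, inner_sub_right,
      inner_shift_toeplitz_shift, inner_shift_shift, sub_self]
  -- The constant is read off from `⟪c, B* (z^(k+1) x)⟫ = ⟪Ψ c, z^(k+1) x⟫ = ⟪ψ_{k+1} c, x⟫`.
  have huc : u = hardyMonomial 0 (ContinuousLinearMap.adjoint (taylorCoeff Ψ (k + 1)) x) := by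
    refine H2_ext_fourierCoeff fun i => ext_inner_left ℂ fun c => ?_
    rw [← inner_hardyMonomial_left, ← inner_hardyMonomial_left]
    cases i with
    | zero =>
      have h1 : ⟪hardyMonomial 0 c, shift (ContinuousLinearMap.adjoint B g)⟫_ℂ = 0 := by
        rw [inner_hardyMonomial_left, fourierCoeff_shift,
          (ContinuousLinearMap.adjoint B g).2 _ (by norm_num), inner_zero_right]
      have h2 : fourierCoeff (hardyMonomial 0
          (ContinuousLinearMap.adjoint (taylorCoeff Ψ (k + 1)) x) : L2 F) ((0 : ℕ) : ℤ) =
          ContinuousLinearMap.adjoint (taylorCoeff Ψ (k + 1)) x := by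
        rw [coe_hardyMonomial, fourierCoeff_monomial, if_pos rfl]
      rw [hu, inner_sub_right, h1, sub_zero, ContinuousLinearMap.adjoint_inner_right, hg,
        shift_hardyMonomial, ← inner_conj_symm, inner_hardyMonomial_left, inner_conj_symm,
        inner_hardyMonomial_left, h2, ContinuousLinearMap.adjoint_inner_right, hψ]
    | succ i =>
      have h2 : fourierCoeff (hardyMonomial 0
          (ContinuousLinearMap.adjoint (taylorCoeff Ψ (k + 1)) x) : L2 F) ((i + 1 : ℕ) : ℤ) = 0 := by
        rw [coe_hardyMonomial, fourierCoeff_monomial, if_neg (by omega)]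
      rw [inner_hardyMonomial_left (i + 1) c (hardyMonomial 0 _), h2, inner_zero_right,
        ← shift_hardyMonomial, hu0]
  rw [ContinuousLinearMap.comp_apply, hθ, ← huc, zero_apply]
  refine ext_inner_left ℂ fun d => ?_
  rw [← inner_hardyMonomial_left, ← shift_hardyMonomial, hAu0, inner_zero_right]

variable [TopologicalSpace.SeparableSpace E]

/-- Needed so that the wandering subspace, a subspace of `L²_E`, is separable. -/
instance secondCountableTopology_L2 : SecondCountableTopology (L2 E) :=
  have : Fact ((2 : ℝ≥0∞) ≠ ∞) := ⟨by norm_num⟩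
  Lp.SecondCountableTopology

end Factorization

/-! ### The factorization of a partially isometric Toeplitz operator. -/

section Main

variable {E F G : Type*} [NormedAddCommGroup E] [InnerProductSpace ℂ E] [CompleteSpace E]
  [TopologicalSpace.SeparableSpace E]
  [NormedAddCommGroup F] [InnerProductSpace ℂ F] [CompleteSpace F]
  [TopologicalSpace.SeparableSpace F]
  [NormedAddCommGroup G] [InnerProductSpace ℂ G] [CompleteSpace G]

/-- If `Θ` and `Ψ` are the inner functions of the wandering subspace of the initial space of a
partially isometric `T_Φ`, and of its image, then `T_Φ = T_Θ T_Ψ^*`. -/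
theorem IsPartialIsometry.toeplitz_eq_comp_adjoint {Φ : LInfty E G}
    (hT : IsPartialIsometry (toeplitz Φ)) {Θ : ℂ → F →L[ℂ] G} {Ψ : ℂ → F →L[ℂ] E}
    (hΘ : IsInner Θ) (hΨ : IsInner Ψ)
    (ι : F → H2 E) (hι : ∀ x, x ∈ wandering (initialSpace (toeplitz Φ)) ↔ ∃ b, ι b = x)
    (hψ : ∀ c, toeplitz hΨ.symbol (hardyMonomial 0 c) = ι c)
    (hθ : ∀ c, toeplitz hΘ.symbol (hardyMonomial 0 c) = toeplitz Φ (ι c)) :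
    toeplitz Φ = toeplitz hΘ.symbol ∘L ContinuousLinearMap.adjoint (toeplitz hΨ.symbol) := by
  have hcomp : toeplitz Φ ∘L toeplitz hΨ.symbol = toeplitz hΘ.symbol := by
    refine clm_ext_hardyMonomial fun n c => ?_
    rw [ContinuousLinearMap.comp_apply, hardyMonomial_eq_iterate, hΨ.toeplitz_shift_iterate,
      hΘ.toeplitz_shift_iterate, hψ, hθ, (hT.shift_iterate_mem_and_eq ((hι _).2 ⟨c, rfl⟩).1 n).2]
  -- A vector killed by `T_Ψ*` is orthogonal to all `S^n c` with `c` wandering, so its component in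
  -- the initial space vanishes.
  have hker : ∀ k, ContinuousLinearMap.adjoint (toeplitz hΨ.symbol) k = 0 →
      toeplitz Φ k = 0 := by
    intro k hk
    obtain ⟨k₁, k₂, h1, h2, rfl⟩ := exists_add_of_initialSpace (toeplitz Φ) k
    have h0 : k₂ = 0 := by
      refine eq_zero_of_inner_wandering_eq_zero (Submodule.isClosed_orthogonal _)
        (fun g hg => (hT.shift_mem_initialSpace_and_eq hg).1) h2 fun c hc n => ?_
      obtain ⟨b, hb⟩ := (hι c).1 hc
      have e : shift^[n] c = toeplitz hΨ.symbol (hardyMonomial n b) := by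
        rw [hardyMonomial_eq_iterate, hΨ.toeplitz_shift_iterate, hψ, hb]
      have h3 : ⟪shift^[n] c, k₁ + k₂⟫_ℂ = 0 := by
        rw [e, ← ContinuousLinearMap.adjoint_inner_right, hk, inner_zero_right]
      have h4 : ⟪shift^[n] c, k₁⟫_ℂ = 0 := by
        exact (inner_eq_zero_symm (𝕜 := ℂ)).1 ((hT.shift_iterate_mem_and_eq hc.1 n).1 k₁ h1)
      rwa [inner_add_right, h4, zero_add] at h3
    rw [h0, add_zero, h1]
  -- As `T_Ψ* T_Ψ = 1`, the vector `g - T_Ψ T_Ψ* g` is killed by `T_Ψ*`, hence by `T_Φ`; that is the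
  -- factorization.
  have hBB := (ContinuousLinearMap.norm_map_iff_adjoint_comp_self _).1 hΨ.norm_toeplitz
  ext1 g
  rw [← hcomp, ContinuousLinearMap.comp_apply, ContinuousLinearMap.comp_apply, ← sub_eq_zero,
    ← map_sub]
  refine hker _ ?_
  rw [map_sub, ← ContinuousLinearMap.comp_apply (ContinuousLinearMap.adjoint _)
    (toeplitz hΨ.symbol), hBB]
  exact sub_self _

/-- A partially isometric Toeplitz operator factors through any Hilbert space `F` identified with
the wandering subspace of its initial space. -/
theorem IsPartialIsometry.exists_isInner_of_wandering {Φ : LInfty E G}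
    (hT : IsPartialIsometry (toeplitz Φ)) (ι : F →ₗᵢ[ℂ] H2 E)
    (hι : ∀ x, x ∈ wandering (initialSpace (toeplitz Φ)) ↔ ∃ b, ι b = x) :
    ∃ (Θ : ℂ → F →L[ℂ] G) (Ψ : ℂ → F →L[ℂ] E) (hΘ : IsInner Θ) (hΨ : IsInner Ψ),
      (∀ m n : ℕ, 1 ≤ m → 1 ≤ n →
        taylorCoeff Θ m ∘L ContinuousLinearMap.adjoint (taylorCoeff Ψ n) = 0) ∧
      toeplitz Φ =
        toeplitz hΘ.symbol ∘L ContinuousLinearMap.adjoint (toeplitz hΨ.symbol) := by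
  have hmem : ∀ c, ι c ∈ wandering (initialSpace (toeplitz Φ)) := fun c => (hι _).2 ⟨c, rfl⟩
  have horth : ∀ (c : F) (n : ℕ), ⟪ι c, shift^[n + 1] (ι c)⟫_ℂ = 0 := by
    intro c n
    rw [Function.iterate_succ_apply']
    exact (inner_eq_zero_symm (𝕜 := ℂ) (E := H2 E)).1
      (inner_shift_of_mem_wandering (hmem c) (hT.shift_iterate_mem_and_eq (hmem c).1 n).1)
  obtain ⟨Ψ, hΨ, hψ, hψ0⟩ := HardyToeplitz.exists_isInner_of_wandering
    ι.toContinuousLinearMap ι.norm_map horth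
  obtain ⟨Θ, hΘ, hθ, hθ0⟩ := HardyToeplitz.exists_isInner_of_wandering
    (toeplitz Φ ∘L ι.toContinuousLinearMap)
    (fun c => (hT _ (hmem c).1).trans (ι.norm_map c)) (fun c n => by
      have h := hT.shift_iterate_mem_and_eq (hmem c).1 (n + 1)
      change ⟪toeplitz Φ (ι c), shift^[n + 1] (toeplitz Φ (ι c))⟫_ℂ = 0
      rw [← h.2, hT.inner_map_map (hmem c).1 h.1, horth])
  have hfac := hT.toeplitz_eq_comp_adjoint hΘ hΨ ι hι hψ0 hθ0
  exact ⟨Θ, Ψ, hΘ, hΨ,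
    taylorCoeff_comp_adjoint_eq_zero hΘ hΨ (fun m c => by rw [hθ0, hθ])
      (fun m c => by rw [hψ0, hψ]) hfac, hfac⟩

theorem IsPartialIsometry.exists_isInner {E : Type u} [NormedAddCommGroup E]
    [InnerProductSpace ℂ E] [CompleteSpace E] [TopologicalSpace.SeparableSpace E] {G : Type v}
    [NormedAddCommGroup G] [InnerProductSpace ℂ G] [CompleteSpace G] {Φ : LInfty E G}
    (hT : IsPartialIsometry (toeplitz Φ)) :
    ∃ (F : Type u) (_ : NormedAddCommGroup F) (_ : InnerProductSpace ℂ F)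
      (_ : CompleteSpace F) (_ : TopologicalSpace.SeparableSpace F)
      (Θ : ℂ → F →L[ℂ] G) (Ψ : ℂ → F →L[ℂ] E) (hΘ : IsInner Θ) (hΨ : IsInner Ψ),
      (∀ m n : ℕ, 1 ≤ m → 1 ≤ n →
        taylorCoeff Θ m ∘L ContinuousLinearMap.adjoint (taylorCoeff Ψ n) = 0) ∧
      toeplitz Φ =
        toeplitz hΘ.symbol ∘L ContinuousLinearMap.adjoint (toeplitz hΨ.symbol) := by
  -- The wandering subspace itself serves as `F`, so `F` lives in the universe of `E`.
  let W := wandering (initialSpace (toeplitz Φ))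
  have hW : CompleteSpace W :=
    (isClosed_wandering (Submodule.isClosed_orthogonal _)).completeSpace_coe
  have hsep : TopologicalSpace.SeparableSpace W := inferInstance
  exact ⟨W, W.normedAddCommGroup, W.innerProductSpace, hW, hsep,
    hT.exists_isInner_of_wandering (F := W) W.subtypeₗᵢ fun x => ⟨fun hx => ⟨⟨x, hx⟩, rfl⟩, by
      rintro ⟨b, rfl⟩
      exact b.2⟩⟩

end Main

end HardyToeplitz

end

theorem mainTheorem5
    {E : Type u} [NormedAddCommGroup E] [InnerProductSpace ℂ E] [CompleteSpace E]
    [TopologicalSpace.SeparableSpace E]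
    {E' : Type v} [NormedAddCommGroup E'] [InnerProductSpace ℂ E'] [CompleteSpace E']
    [TopologicalSpace.SeparableSpace E']
    (Φ : HardyToeplitz.LInfty E E')
    (hΦ : ¬ ∀ᵐ t ∂HardyToeplitz.circleMeasure, Φ t = 0) :
    HardyToeplitz.IsPartialIsometry (HardyToeplitz.toeplitz Φ) ↔
      ∃ (F : Type u) (_ : NormedAddCommGroup F) (_ : InnerProductSpace ℂ F)
        (_ : CompleteSpace F) (_ : TopologicalSpace.SeparableSpace F)
        (Θ : ℂ → F →L[ℂ] E') (Ψ : ℂ → F →L[ℂ] E)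
        (hΘ : HardyToeplitz.IsInner Θ) (hΨ : HardyToeplitz.IsInner Ψ),
        (∀ m n : ℕ, 1 ≤ m → 1 ≤ n →
          HardyToeplitz.taylorCoeff Θ m ∘L
            ContinuousLinearMap.adjoint (HardyToeplitz.taylorCoeff Ψ n) = 0) ∧
        HardyToeplitz.toeplitz Φ =
          HardyToeplitz.toeplitz hΘ.symbol ∘L
            ContinuousLinearMap.adjoint (HardyToeplitz.toeplitz hΨ.symbol) := by
  refine ⟨fun hT => hT.exists_isInner, ?_⟩
  rintro ⟨F, _, _, _, _, Θ, Ψ, hΘ, hΨ, -, hfac⟩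
  rw [hfac]
  exact HardyToeplitz.isPartialIsometry_comp_adjoint hΘ.norm_toeplitz hΨ.norm_toeplitz
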